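/- Let $(x_n)_{n\in\mathbb Z}$ be a real, centred, stationary Gaussian process with a spectral density $S\ge 0$ that is twice continuously differentiable on $[-\frac12,\frac12]$, i.e. $\mathrm{Cov}(x_n,x_m)=\int_{-1/2}^{1/2}S(g)e^{2\pi i(n-m)g}\,dg$. For $1\le K\le N$ let $$\widehat S_{N,K}(f)=\frac1K\sum_{k=1}^{K}\Bigl|\sum_{n=1}^{N}v^{(k)}_n x_n e^{-2\pi i n f}\Bigr|^2,\qquad v^{(k)}_n=\sqrt{\tfrac{2}{N+1}}\,\sin\frac{\pi k n}{N+1},$$ be the uniformly weighted multitaper estimate with $K$ sinusoidal tapers, and let $$L_{N,K}(f)=\bigl(E[\widehat S_{N,K}(f)]-S(f)\bigr)^2+\mathrm{Var}\bigl[\widehat S_{N,K}(f)\bigr],\qquad A_{N,K}(f)=\Bigl[\frac{S''(f)K^2}{24N^2}\Bigr]^2+\frac{S(f)^2}{K}$$ be its local loss ($\mathrm{Bias}^2+\mathrm{Variance}$) and the claimed asymptotic local loss. Theorem. Fix $f\in(-\frac12,\frac12)$ with $f\neq0$, and let $K=K_N\ge1$ be integers with $K_N/N\to0$ as $N\to\infty$.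 Then $$L_{N,K_N}(f)=A_{N,K_N}(f)+o\Bigl(\frac{K_N^4}{N^4}+\frac1{K_N}\Bigr)\qquad(N\to\infty).$$ If moreover $S''(f)\neq0$, and either $S(f)\ne0$ or $K_N\to\infty$, then $L_{N,K_N}(f)/A_{N,K_N}(f)\to1$, i.e. $\mathrm{Bias}^2+\mathrm{Variance}\simeq\bigl[\frac{S''(f)K^2}{24N^2}\bigr]^2+\frac{S(f)^2}{K}$. -/

import Mathlib

open MeasureTheory ProbabilityTheory Filter Asymptotics
open scoped Topology

/-- The `k`-th sinusoidal taper of length `N`: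
`v_n^{(k)} = √(2/(N+1)) sin (π k n / (N+1))`, for `1 ≤ k ≤ N` and `1 ≤ n ≤ N`. -/
noncomputable def sinusoidalTaper (N k n : ℕ) : ℝ :=
  Real.sqrt (2 / ((N : ℝ) + 1)) * Real.sin (Real.pi * k * n / ((N : ℝ) + 1))

/-- The multitaper spectral estimate at frequency `f` from the data `x_1, …, x_N`, with the
`K` tapers `v^{(1)}, …, v^{(K)}` and the weights `w_1, …, w_K`:
`∑_{k=1}^K w_k |∑_{n=1}^N v_n^{(k)} x_n e^{-2πinf}|²`. -/
noncomputable def multitaperEstimate (N K : ℕ) (w : ℕ → ℝ) (v : ℕ → ℕ → ℝ)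
    (x : ℤ → ℝ) (f : ℝ) : ℝ :=
  ∑ k ∈ Finset.Icc 1 K, w k *
    ‖∑ n ∈ Finset.Icc 1 N, (v k n : ℂ) * (x (n : ℤ) : ℂ) *
      Complex.exp (-(2 * Real.pi * n * f : ℝ) * Complex.I)‖ ^ 2

/-- The uniformly weighted (`w_k = 1/K`) multitaper estimate with the first `K` sinusoidal
tapers. -/
noncomputable def sinusoidalMultitaperEstimate (N K : ℕ) (x : ℤ → ℝ) (f : ℝ) : ℝ :=
  multitaperEstimate N K (fun _ => 1 / (K : ℝ)) (sinusoidalTaper N) x f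

/-- `S`, a function on the frequency domain `[-1/2, 1/2]` (its values elsewhere play no role), is
the spectral density of the centred, real, weakly stationary process `x`:
`E[x_n] = 0` and `Cov(x_n, x_m) = ∫_{-1/2}^{1/2} S(g) e^{2πi(n-m)g} dg` with `S ≥ 0` integrable. -/
structure HasSpectralDensity {Ω : Type*} [MeasurableSpace Ω] (x : ℤ → Ω → ℝ) (P : Measure Ω)
    (S : ℝ → ℝ) : Prop where
  memLp : ∀ n, MemLp (x n) 2 P
  centered : ∀ n, ∫ ω, x n ω ∂P = 0
  nonneg : ∀ g ∈ Set.Icc (-1 / 2 : ℝ) (1 / 2), 0 ≤ S g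
  integrable : IntervalIntegrable S volume (-1 / 2) (1 / 2)
  covariance_eq : ∀ n m : ℤ, (cov[x n, x m; P] : ℂ) =
    ∫ g in (-1 / 2 : ℝ)..(1 / 2),
      (S g : ℂ) * Complex.exp ((2 * Real.pi * ((n : ℝ) - m) * g : ℝ) * Complex.I)

/-- The bias `E[Ŝ] - s` of an estimator `Ŝ` of the number `s`. -/
noncomputable def estimatorBias {Ω : Type*} [MeasurableSpace Ω] (P : Measure Ω)
    (Shat : Ω → ℝ) (s : ℝ) : ℝ :=
  (∫ ω, Shat ω ∂P) - s

/-- The local loss of the estimator `Ŝ` of the number `s`: squared bias plus variance. -/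
noncomputable def localLoss {Ω : Type*} [MeasurableSpace Ω] (P : Measure Ω)
    (Shat : Ω → ℝ) (s : ℝ) : ℝ :=
  estimatorBias P Shat s ^ 2 + Var[Shat; P]

/-- The asymptotic local loss `[S''(f) K² / (24 N²)]² + S(f)² / K`. -/
noncomputable def asymptoticLoss (S : ℝ → ℝ) (f : ℝ) (N K : ℕ) : ℝ :=
  (iteratedDeriv 2 S f * (K : ℝ) ^ 2 / (24 * (N : ℝ) ^ 2)) ^ 2 + S f ^ 2 / (K : ℝ)

/-! ### Fourth moments of Gaussian variables and Wick's formula for squares. -/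

section GaussianMoments

variable {Ω : Type*} [MeasurableSpace Ω] {P : Measure Ω}

/-! Write `U_k` for the Fourier transform of the `k`-th taper centred at `f`, and `a = (K/N)²`. The
mean of the estimate is the average of `S` against the window `(1/K) ∑ |U_k|²`. By Wick's formula
its variance is `1/K²` times the sum of `|∫ S U_j conj U_k|²`, plus the same sum with `U_k`
recentred at `-f` (`variance_multitaperEstimate`).

Everything rests on the tapers being eigenvectors of the discrete Dirichlet Laplacian.
Multiplication by `4 sin²(π(g-f))` is that Laplacian on the frequency side, so up to two boundary
terms it multiplies `U_k` by its eigenvalue (`four_sin_sq_mul_taperWave`). Hence the weight `sin²`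
is exactly diagonal in the tapers, with entries `sin²(πk/(2(N+1)))`, whose mean over `k ≤ K` is
`π²a/12` to leading order; and the `sin⁴` average is `o(a)`.

Bias: expand `S` at `f` in `1`, `sin(2π(g-f))` and `sin²(π(g-f))` instead of monomials. The constant
reproduces `S(f)`, the odd term integrates to zero, the `sin²` term gives `S''(f)/(2π²) · π²a/12 =
S''(f)a/24`, and the remainder is at most `ε sin² + C_ε sin⁴`, so its average is `o(a)`
(`windowAvg_sub_sub_isLittleO`).

Variance: orthonormality makes the constant part of `S` contribute `S(f)²/K`. Bessel's inequality
bounds the contribution of `S - S(f)`, and also the sum at `-f`: since `sin(2πf) ≠ 0`, `S` splits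
there into two weights, each vanishing at one of the two window centres. All errors are `o(1/K)`
(`abs_variance_sub_le`).

If `S(f) = 0`, an error `o(1/K)` is too coarse for the ratio. Then `f` is a minimum of `S`, so
`S'(f) = 0` and `S` is a multiple of `sin²` plus the remainder. The diagonal part costs `O(a²/K)`,
and Cauchy-Schwarz makes the other parts `o(a²)` (`variance_le_of_eq_sin_sq_add`); this is where `K
→ ∞` enters. -/

lemma integral_pow_four_gaussianReal (v : NNReal) :
    ∫ z, z ^ 4 ∂(gaussianReal 0 v) = 3 * (v : ℝ) ^ 2 := by
  have h := iteratedDeriv_mgf_zero (X := id) (μ := gaussianReal 0 v)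
    (by simp [integrableExpSet_id_gaussianReal]) 4
  -- A cubic times `exp (v t² / 2)` covers the moment generating function and its first three
  -- derivatives, so one formula serves all four differentiations.
  have hd : ∀ (a b c d e : ℝ) (t : ℝ), HasDerivAt
      (fun t : ℝ => (a + b * t + c * t ^ 2 + d * t ^ 3) * Real.exp (v * t ^ 2 / 2))
      ((b + 2 * c * t + 3 * d * t ^ 2 + (a + b * t + c * t ^ 2 + d * t ^ 3) * (v * t)) *
        Real.exp (v * t ^ 2 / 2)) t := by
    intro a b c d e t
    have h1 : HasDerivAt (fun t : ℝ => a + b * t + c * t ^ 2 + d * t ^ 3)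
        (b + 2 * c * t + 3 * d * t ^ 2) t := by
      have := ((((hasDerivAt_id' t).const_mul b).const_add a).fun_add
        ((hasDerivAt_pow 2 t).const_mul c)).fun_add ((hasDerivAt_pow 3 t).const_mul d)
      exact this.congr_deriv (by norm_num; try ring)
    have h2 : HasDerivAt (fun t : ℝ => Real.exp (v * t ^ 2 / 2))
        (Real.exp (v * t ^ 2 / 2) * (v * t)) t := by
      have := (((hasDerivAt_pow 2 t).const_mul (v : ℝ)).div_const 2).exp
      exact this.congr_deriv (by norm_num; try ring)
    exact (h1.fun_mul h2).congr_deriv (by ring)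
  have h0 : mgf id (gaussianReal 0 v) = fun t => Real.exp (v * t ^ 2 / 2) := by
    rw [mgf_id_gaussianReal]; simp
  have e1 : deriv (fun t : ℝ => Real.exp (v * t ^ 2 / 2)) =
      fun t => (v * t) * Real.exp (v * t ^ 2 / 2) := by
    ext t
    have := (hd 1 0 0 0 0 t).deriv
    simpa using this
  have e2 : deriv (fun t : ℝ => (v * t) * Real.exp (v * t ^ 2 / 2)) =
      fun t => (v + v ^ 2 * t ^ 2) * Real.exp (v * t ^ 2 / 2) := by
    ext t
    have := (hd 0 v 0 0 0 t).deriv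
    simp only [zero_add, zero_mul, add_zero, mul_zero] at this
    rw [this]; ring
  have e3 : deriv (fun t : ℝ => (v + v ^ 2 * t ^ 2) * Real.exp (v * t ^ 2 / 2)) =
      fun t => (3 * v ^ 2 * t + v ^ 3 * t ^ 3) * Real.exp (v * t ^ 2 / 2) := by
    ext t
    have := (hd v 0 (v ^ 2) 0 0 t).deriv
    simp only [zero_add, zero_mul, add_zero, mul_zero] at this
    rw [this]; ring
  have e4 : deriv (fun t : ℝ => (3 * v ^ 2 * t + v ^ 3 * t ^ 3) * Real.exp (v * t ^ 2 / 2)) 0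
      = 3 * (v : ℝ) ^ 2 := by
    have := (hd 0 (3 * (v : ℝ) ^ 2) 0 ((v : ℝ) ^ 3) 0 0).deriv
    simp only [zero_add, zero_mul, add_zero, mul_zero] at this
    rw [this]; simp
  rw [h0, iteratedDeriv_succ', iteratedDeriv_succ', iteratedDeriv_succ', iteratedDeriv_one,
    e1, e2, e3, e4] at h
  simpa using h.symm

lemma ProbabilityTheory.HasGaussianLaw.integral_pow_four {Z : Ω → ℝ} (hZ : HasGaussianLaw Z P)
    (h0 : ∫ ω, Z ω ∂P = 0) : ∫ ω, Z ω ^ 4 ∂P = 3 * (∫ ω, Z ω ^ 2 ∂P) ^ 2 := by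
  have := hZ.isProbabilityMeasure
  have hm := hZ.map_eq_gaussianReal
  rw [h0] at hm
  have hv : Var[Z; P] = ∫ ω, Z ω ^ 2 ∂P := variance_of_integral_eq_zero hZ.aemeasurable h0
  have h4 : ∫ ω, Z ω ^ 4 ∂P = ∫ z, z ^ 4 ∂(P.map Z) :=
    (integral_map hZ.aemeasurable (f := fun z : ℝ => z ^ 4) (by fun_prop)).symm
  rw [h4, hm, integral_pow_four_gaussianReal, Real.coe_toNNReal _ (variance_nonneg _ _), hv]

lemma ProbabilityTheory.HasGaussianLaw.integrable_pow {Z : Ω → ℝ} (hZ : HasGaussianLaw Z P)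
    (n : ℕ) : Integrable (fun ω => Z ω ^ n) P := by
  have := hZ.isProbabilityMeasure
  rcases Nat.eq_zero_or_pos n with rfl | hn
  · simp
  have h := (hZ.memLp (p := n) (by simp)).integrable_norm_pow hn.ne'
  refine h.mono (hZ.aemeasurable.pow_const n).aestronglyMeasurable ?_
  filter_upwards with ω
  simp

/-- Wick's formula for the squares of two jointly Gaussian centred variables. -/
lemma covariance_sq_sq_of_hasGaussianLaw {p q : Ω → ℝ}
    (hadd : HasGaussianLaw (fun ω => p ω + q ω) P) (hsub : HasGaussianLaw (fun ω => p ω - q ω) P)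
    (hp : HasGaussianLaw p P) (hq : HasGaussianLaw q P)
    (hp0 : ∫ ω, p ω ∂P = 0) (hq0 : ∫ ω, q ω ∂P = 0) :
    cov[fun ω => p ω ^ 2, fun ω => q ω ^ 2; P] = 2 * cov[p, q; P] ^ 2 := by
  have := hp.isProbabilityMeasure
  have ip1 := hp.integrable
  have iq1 := hq.integrable
  have ip2 := hp.integrable_pow 2
  have iq2 := hq.integrable_pow 2
  have ip4 := hp.integrable_pow 4
  have iq4 := hq.integrable_pow 4
  have ia4 := hadd.integrable_pow 4
  have is4 := hsub.integrable_pow 4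
  have ia2 := hadd.integrable_pow 2
  have is2 := hsub.integrable_pow 2
  have a0 : ∫ ω, (p ω + q ω) ∂P = 0 := by rw [integral_add ip1 iq1, hp0, hq0, add_zero]
  have s0 : ∫ ω, (p ω - q ω) ∂P = 0 := by rw [integral_sub ip1 iq1, hp0, hq0, sub_zero]
  have ma := hadd.integral_pow_four a0
  have ms := hsub.integral_pow_four s0
  have mp := hp.integral_pow_four hp0
  have mq := hq.integral_pow_four hq0
  have ipq : Integrable (fun ω => p ω * q ω) P := by
    have : (fun ω => p ω * q ω) = fun ω => (1 / 4) * ((p ω + q ω) ^ 2 - (p ω - q ω) ^ 2) := by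
      ext ω; ring
    rw [this]; exact (ia2.sub is2).const_mul _
  have i1 : Integrable (fun ω => (p ω + q ω) ^ 4 + (p ω - q ω) ^ 4) P := ia4.add is4
  have i2 : Integrable (fun ω => (p ω + q ω) ^ 4 + (p ω - q ω) ^ 4 - 2 * p ω ^ 4) P :=
    i1.sub (ip4.const_mul 2)
  have i3 : Integrable (fun ω => p ω ^ 2 + 2 * (p ω * q ω)) P := ip2.add (ipq.const_mul 2)
  have i4 : Integrable (fun ω => p ω ^ 2 - 2 * (p ω * q ω)) P := ip2.sub (ipq.const_mul 2)
  -- Polarisation: the mixed moment reduces to fourth moments of `p ± q`, `p` and `q`, so only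
  -- one-dimensional Gaussian laws are needed.
  have e22 : 12 * ∫ ω, p ω ^ 2 * q ω ^ 2 ∂P = ∫ ω, (p ω + q ω) ^ 4 ∂P + ∫ ω, (p ω - q ω) ^ 4 ∂P
      - 2 * ∫ ω, p ω ^ 4 ∂P - 2 * ∫ ω, q ω ^ 4 ∂P := by
    simp only [← integral_const_mul]
    rw [← integral_add ia4 is4, ← integral_sub i1 (ip4.const_mul 2),
      ← integral_sub i2 (iq4.const_mul 2)]
    congr 1; ext ω; ring
  have ea2 : ∫ ω, (p ω + q ω) ^ 2 ∂P = ∫ ω, p ω ^ 2 ∂P + 2 * ∫ ω, p ω * q ω ∂P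
      + ∫ ω, q ω ^ 2 ∂P := by
    rw [← integral_const_mul, ← integral_add ip2 (ipq.const_mul 2),
      ← integral_add i3 iq2]
    congr 1; ext ω; ring
  have es2 : ∫ ω, (p ω - q ω) ^ 2 ∂P = ∫ ω, p ω ^ 2 ∂P - 2 * ∫ ω, p ω * q ω ∂P
      + ∫ ω, q ω ^ 2 ∂P := by
    rw [← integral_const_mul, ← integral_sub ip2 (ipq.const_mul 2),
      ← integral_add i4 iq2]
    congr 1; ext ω; ring
  have c1 : cov[p, q; P] = ∫ ω, p ω * q ω ∂P := by
    rw [covariance_eq_sub hp.memLp_two hq.memLp_two, hp0]; simp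
  have lp2 : MemLp (fun ω => p ω ^ 2) 2 P := by
    rw [memLp_two_iff_integrable_sq (hp.aemeasurable.pow_const 2).aestronglyMeasurable]
    simpa [← pow_mul] using ip4
  have lq2 : MemLp (fun ω => q ω ^ 2) 2 P := by
    rw [memLp_two_iff_integrable_sq (hq.aemeasurable.pow_const 2).aestronglyMeasurable]
    simpa [← pow_mul] using iq4
  rw [c1, covariance_eq_sub lp2 lq2]
  simp only [Pi.mul_apply]
  rw [ma, ms, mp, mq, ea2, es2] at e22
  linear_combination (1 / 12) * e22

end GaussianMoments

/-! ### Mean and variance of a multitaper estimate as integrals against the spectral density. -/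

section SpectralRepresentation

/-- The trigonometric polynomial `g ↦ ∑_{n=1}^N u_n e^{2πin(g-h)}`. -/
noncomputable def taperWave (N : ℕ) (u : ℕ → ℝ) (h g : ℝ) : ℂ :=
  ∑ n ∈ Finset.Icc 1 N, (u n : ℂ) * Complex.exp ((2 * Real.pi * n * (g - h) : ℝ) * Complex.I)

/-- The sesquilinear form `(F, G) ↦ ∫_{-1/2}^{1/2} S F conj(G)`. -/
noncomputable def spectralForm (S : ℝ → ℝ) (F G : ℝ → ℂ) : ℂ :=
  ∫ g in (-1 / 2 : ℝ)..(1 / 2), (S g : ℂ) * (F g * (starRingEnd ℂ) (G g))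

lemma continuous_taperWave (N : ℕ) (u : ℕ → ℝ) (h : ℝ) : Continuous (taperWave N u h) := by
  unfold taperWave; fun_prop

variable {Ω : Type*} [MeasurableSpace Ω] {P : Measure Ω} {x : ℤ → Ω → ℝ} {S : ℝ → ℝ}

/-- The linear combination `∑_{n=1}^N a_n x_n` of the data. -/
noncomputable def dataComb (x : ℤ → Ω → ℝ) (N : ℕ) (a : ℕ → ℝ) (ω : Ω) : ℝ :=
  ∑ n ∈ Finset.Icc 1 N, a n * x (n : ℤ) ω

lemma hasGaussianLaw_dataComb (hx : IsGaussianProcess x P) (N : ℕ) (a : ℕ → ℝ) :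
    HasGaussianLaw (dataComb x N a) P := by
  exact ((hx.comp_right (fun n : ℕ => (n : ℤ))).smul a).hasGaussianLaw_fun_sum
    (I := Finset.Icc 1 N)

lemma integral_dataComb (hx : HasSpectralDensity x P S) [IsFiniteMeasure P] (N : ℕ) (a : ℕ → ℝ) :
    ∫ ω, dataComb x N a ω ∂P = 0 := by
  unfold dataComb
  rw [integral_finsetSum]
  · simp [integral_const_mul, hx.centered]
  · intro n _
    exact ((hx.memLp n).integrable (by norm_num)).const_mul _

lemma covariance_dataComb (hx : HasSpectralDensity x P S) [IsProbabilityMeasure P] (N : ℕ)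
    (a b : ℕ → ℝ) : cov[dataComb x N a, dataComb x N b; P] =
      ∑ n ∈ Finset.Icc 1 N, ∑ m ∈ Finset.Icc 1 N, a n * b m * cov[x n, x m; P] := by
  unfold dataComb
  rw [covariance_fun_sum_left' (X := fun (n : ℕ) ω => a n * x n ω)
    (fun n _ => (hx.memLp n).const_mul _)
    (Y := fun ω => ∑ n ∈ Finset.Icc 1 N, b n * x (n : ℤ) ω)
    (memLp_finsetSum _ fun n _ => (hx.memLp n).const_mul _)]
  refine Finset.sum_congr rfl fun n _ => ?_
  rw [covariance_fun_sum_right' (X := fun (n : ℕ) ω => b n * x n ω)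
    (fun n _ => (hx.memLp n).const_mul _) ((hx.memLp n).const_mul _)]
  refine Finset.sum_congr rfl fun m _ => ?_
  rw [covariance_const_mul_left, covariance_const_mul_right]
  ring

lemma covariance_sq_dataComb (hg : IsGaussianProcess x P) (hx : HasSpectralDensity x P S)
    (N : ℕ) (a b : ℕ → ℝ) :
    cov[fun ω => dataComb x N a ω ^ 2, fun ω => dataComb x N b ω ^ 2; P] =
      2 * cov[dataComb x N a, dataComb x N b; P] ^ 2 := by
  have := hg.isProbabilityMeasure
  refine covariance_sq_sq_of_hasGaussianLaw ?_ ?_ (hasGaussianLaw_dataComb hg N a)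
    (hasGaussianLaw_dataComb hg N b) (integral_dataComb hx N a) (integral_dataComb hx N b)
  · convert hasGaussianLaw_dataComb hg N (a + b) using 2 with ω
    simp [dataComb, add_mul, Finset.sum_add_distrib]
  · convert hasGaussianLaw_dataComb hg N (a - b) using 2 with ω
    simp [dataComb, sub_mul, Finset.sum_sub_distrib]

lemma memLp_sq_dataComb (hg : IsGaussianProcess x P) (N : ℕ) (a : ℕ → ℝ) :
    MemLp (fun ω => dataComb x N a ω ^ 2) 2 P := by
  have h := hasGaussianLaw_dataComb hg N a
  rw [memLp_two_iff_integrable_sq (h.aemeasurable.pow_const 2).aestronglyMeasurable]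
  simpa [← pow_mul] using h.integrable_pow 4

/-- For fixed `g` the kernel `e^{2πi(n-m)g}` is a product of a factor in `n` and a factor in `m`, so
the double sum factors under the integral. -/
lemma sum_mul_covariance_eq_integral (hx : HasSpectralDensity x P S)
    (hS : ContinuousOn S (Set.Icc (-1 / 2) (1 / 2))) (N : ℕ) (a b : ℕ → ℂ) :
    ∑ n ∈ Finset.Icc 1 N, ∑ m ∈ Finset.Icc 1 N, a n * b m * (cov[x n, x m; P] : ℂ) =
      ∫ g in (-1 / 2 : ℝ)..(1 / 2), (S g : ℂ) *
        ((∑ n ∈ Finset.Icc 1 N, a n * Complex.exp ((2 * Real.pi * n * g : ℝ) * Complex.I)) *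
          ∑ m ∈ Finset.Icc 1 N, b m * Complex.exp (-((2 * Real.pi * m * g : ℝ) * Complex.I))) := by
  have hS' : ContinuousOn (fun g => (S g : ℂ)) (Set.uIcc (-1 / 2 : ℝ) (1 / 2)) := by
    rw [Set.uIcc_of_le (by norm_num)]
    exact Complex.continuous_ofReal.comp_continuousOn hS
  simp_rw [Finset.sum_mul_sum, Finset.mul_sum]
  rw [intervalIntegral.integral_finsetSum]
  · refine Finset.sum_congr rfl fun n _ => ?_
    rw [intervalIntegral.integral_finsetSum]
    · refine Finset.sum_congr rfl fun m _ => ?_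
      rw [hx.covariance_eq, ← intervalIntegral.integral_const_mul]
      refine intervalIntegral.integral_congr fun g _ => ?_
      have : Complex.exp ((2 * Real.pi * (((n : ℤ) : ℝ) - ((m : ℤ) : ℝ)) * g : ℝ) * Complex.I) =
          Complex.exp ((2 * Real.pi * n * g : ℝ) * Complex.I) *
            Complex.exp (-((2 * Real.pi * m * g : ℝ) * Complex.I)) := by
        rw [← Complex.exp_add]; congr 1; push_cast; ring
      simp only [this]; ring
    · intro m _
      exact (hS'.mul (by fun_prop)).intervalIntegrable
  · intro n _
    exact (continuousOn_finsetSum _ fun m _ => hS'.mul (by fun_prop)).intervalIntegrable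

/-- The covariance form of the vectors `a_n e^{-2πinf}`, `b_n e^{-2πinh}` (not conjugated). -/
lemma spectralForm_taperWave (hx : HasSpectralDensity x P S)
    (hS : ContinuousOn S (Set.Icc (-1 / 2) (1 / 2))) (N : ℕ) (a b : ℕ → ℝ) (f h : ℝ) :
    spectralForm S (taperWave N a f) (taperWave N b h) =
      ∑ n ∈ Finset.Icc 1 N, ∑ m ∈ Finset.Icc 1 N,
        ((a n : ℂ) * Complex.exp (-((2 * Real.pi * n * f : ℝ) * Complex.I))) *
        ((b m : ℂ) * Complex.exp ((2 * Real.pi * m * h : ℝ) * Complex.I)) *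
          (cov[x n, x m; P] : ℂ) := by
  rw [sum_mul_covariance_eq_integral hx hS, spectralForm]
  refine intervalIntegral.integral_congr fun g _ => ?_
  simp only [taperWave, map_sum, map_mul, Complex.conj_ofReal, ← Complex.exp_conj, Complex.conj_I]
  congr 2
  · refine Finset.sum_congr rfl fun n _ => ?_
    rw [mul_assoc (Complex.ofReal _), ← Complex.exp_add]; congr 2; push_cast; ring
  · refine Finset.sum_congr rfl fun n _ => ?_
    rw [mul_assoc (Complex.ofReal _), ← Complex.exp_add]; congr 2; push_cast; ring

/-- Real part `u_n cos(2πnf)` of `u_n e^{2πinf}`. -/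
noncomputable def cosComb (u : ℕ → ℝ) (f : ℝ) (n : ℕ) : ℝ := u n * Real.cos (2 * Real.pi * n * f)

/-- Imaginary part `u_n sin(2πnf)` of `u_n e^{2πinf}`. -/
noncomputable def sinComb (u : ℕ → ℝ) (f : ℝ) (n : ℕ) : ℝ := u n * Real.sin (2 * Real.pi * n * f)

lemma spectralForm_taperWave_re_im (hx : HasSpectralDensity x P S) [IsProbabilityMeasure P]
    (hS : ContinuousOn S (Set.Icc (-1 / 2) (1 / 2))) (N : ℕ) (a b : ℕ → ℝ) (f : ℝ) :
    spectralForm S (taperWave N a f) (taperWave N b f) =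
      ⟨cov[dataComb x N (cosComb a f), dataComb x N (cosComb b f); P] +
        cov[dataComb x N (sinComb a f), dataComb x N (sinComb b f); P],
       cov[dataComb x N (cosComb a f), dataComb x N (sinComb b f); P] -
        cov[dataComb x N (sinComb a f), dataComb x N (cosComb b f); P]⟩ := by
  rw [spectralForm_taperWave hx hS]
  simp only [covariance_dataComb hx, ← Finset.sum_add_distrib, ← Finset.sum_sub_distrib]
  apply Complex.ext
  all_goals
    simp only [Complex.re_sum, Complex.im_sum]
    refine Finset.sum_congr rfl fun n _ => Finset.sum_congr rfl fun m _ => ?_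
    rw [← neg_mul, ← Complex.ofReal_neg, Complex.exp_ofReal_mul_I, Complex.exp_ofReal_mul_I,
      Real.cos_neg, Real.sin_neg]
    simp [cosComb, sinComb, -Complex.ofReal_sin, -Complex.ofReal_cos]
    ring

/-- With real data and tapers, moving the second wave to `-f` conjugates the second Fourier
coefficient. This form is therefore the pseudo-covariance `E[Y_a Y_b]`, where the form at `f` is
`E[Y_a conj Y_b]`. -/
lemma spectralForm_taperWave_neg_re_im (hx : HasSpectralDensity x P S) [IsProbabilityMeasure P]
    (hS : ContinuousOn S (Set.Icc (-1 / 2) (1 / 2))) (N : ℕ) (a b : ℕ → ℝ) (f : ℝ) :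
    spectralForm S (taperWave N a f) (taperWave N b (-f)) =
      ⟨cov[dataComb x N (cosComb a f), dataComb x N (cosComb b f); P] -
        cov[dataComb x N (sinComb a f), dataComb x N (sinComb b f); P],
       -cov[dataComb x N (cosComb a f), dataComb x N (sinComb b f); P] -
        cov[dataComb x N (sinComb a f), dataComb x N (cosComb b f); P]⟩ := by
  rw [spectralForm_taperWave hx hS]
  simp only [covariance_dataComb hx, ← Finset.sum_neg_distrib, ← Finset.sum_sub_distrib]
  apply Complex.ext
  all_goals
    simp only [Complex.re_sum, Complex.im_sum]
    refine Finset.sum_congr rfl fun n _ => Finset.sum_congr rfl fun m _ => ?_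
    rw [← neg_mul, ← Complex.ofReal_neg, mul_neg, Complex.exp_ofReal_mul_I,
      Complex.exp_ofReal_mul_I,
      Real.cos_neg, Real.sin_neg, Real.cos_neg, Real.sin_neg]
    simp [cosComb, sinComb, -Complex.ofReal_sin, -Complex.ofReal_cos]
    ring

lemma multitaperEstimate_eq_sum_sq {Ω : Type*} (N K : ℕ) (w : ℕ → ℝ) (v : ℕ → ℕ → ℝ) (x : ℤ → Ω → ℝ) (f : ℝ)
    (ω : Ω) : multitaperEstimate N K w v (fun n => x n ω) f = ∑ k ∈ Finset.Icc 1 K, w k *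
      (dataComb x N (cosComb (v k) f) ω ^ 2 + dataComb x N (sinComb (v k) f) ω ^ 2) := by
  refine Finset.sum_congr rfl fun k _ => ?_
  rw [← Complex.normSq_eq_norm_sq, Complex.normSq_apply]
  have h : ∑ n ∈ Finset.Icc 1 N, (v k n : ℂ) * (x (n : ℤ) ω : ℂ) *
      Complex.exp (-(2 * Real.pi * n * f : ℝ) * Complex.I) =
      ⟨dataComb x N (cosComb (v k) f) ω, -dataComb x N (sinComb (v k) f) ω⟩ := by
    simp only [dataComb, ← Finset.sum_neg_distrib]
    apply Complex.ext
    all_goals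
      simp only [Complex.re_sum, Complex.im_sum]
      refine Finset.sum_congr rfl fun n _ => ?_
      rw [← Complex.ofReal_neg, Complex.exp_ofReal_mul_I,
        Real.cos_neg, Real.sin_neg]
      simp [cosComb, sinComb, -Complex.ofReal_sin, -Complex.ofReal_cos]
      ring
  rw [h]; ring

lemma integral_sq_dataComb (hg : IsGaussianProcess x P) (hx : HasSpectralDensity x P S) (N : ℕ)
    (a : ℕ → ℝ) :
    ∫ ω, dataComb x N a ω ^ 2 ∂P = cov[dataComb x N a, dataComb x N a; P] := by
  have := hg.isProbabilityMeasure
  have hm := (hasGaussianLaw_dataComb hg N a).aemeasurable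
  rw [covariance_self hm, variance_of_integral_eq_zero hm (integral_dataComb hx N a)]

lemma integral_multitaperEstimate (hg : IsGaussianProcess x P) (hx : HasSpectralDensity x P S)
    (hS : ContinuousOn S (Set.Icc (-1 / 2) (1 / 2))) (N K : ℕ) (w : ℕ → ℝ) (v : ℕ → ℕ → ℝ)
    (f : ℝ) : ∫ ω, multitaperEstimate N K w v (fun n => x n ω) f ∂P =
      ∑ k ∈ Finset.Icc 1 K,
        w k * (spectralForm S (taperWave N (v k) f) (taperWave N (v k) f)).re := by
  have := hg.isProbabilityMeasure
  simp only [multitaperEstimate_eq_sum_sq]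
  have i : ∀ a, Integrable (fun ω => dataComb x N a ω ^ 2) P :=
    fun a => (hasGaussianLaw_dataComb hg N a).integrable_pow 2
  have i' : ∀ a b, Integrable (fun ω => dataComb x N a ω ^ 2 + dataComb x N b ω ^ 2) P :=
    fun a b => (i a).add (i b)
  rw [integral_finsetSum _ fun k _ => (i' _ _).const_mul _]
  refine Finset.sum_congr rfl fun k _ => ?_
  rw [integral_const_mul, integral_add (i _) (i _), spectralForm_taperWave_re_im hx hS,
    integral_sq_dataComb hg hx, integral_sq_dataComb hg hx]

lemma variance_multitaperEstimate (hg : IsGaussianProcess x P) (hx : HasSpectralDensity x P S)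
    (hS : ContinuousOn S (Set.Icc (-1 / 2) (1 / 2))) (N K : ℕ) (w : ℕ → ℝ) (v : ℕ → ℕ → ℝ)
    (f : ℝ) : Var[fun ω => multitaperEstimate N K w v (fun n => x n ω) f; P] =
      ∑ j ∈ Finset.Icc 1 K, ∑ k ∈ Finset.Icc 1 K, w j * w k *
        (‖spectralForm S (taperWave N (v j) f) (taperWave N (v k) f)‖ ^ 2 +
          ‖spectralForm S (taperWave N (v j) f) (taperWave N (v k) (-f))‖ ^ 2) := by
  have := hg.isProbabilityMeasure
  simp only [multitaperEstimate_eq_sum_sq]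
  have i : ∀ a, MemLp (fun ω => dataComb x N a ω ^ 2) 2 P := memLp_sq_dataComb hg N
  have i2 : ∀ k, MemLp (fun ω => dataComb x N (cosComb (v k) f) ω ^ 2 +
      dataComb x N (sinComb (v k) f) ω ^ 2) 2 P := fun k => (i _).add (i _)
  have i3 : ∀ k, MemLp (fun ω => w k * (dataComb x N (cosComb (v k) f) ω ^ 2 +
      dataComb x N (sinComb (v k) f) ω ^ 2)) 2 P := fun k => (i2 k).const_mul _
  have hadd : ∀ a b c d, cov[fun ω => dataComb x N a ω ^ 2 + dataComb x N b ω ^ 2,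
      fun ω => dataComb x N c ω ^ 2 + dataComb x N d ω ^ 2; P] =
      cov[fun ω => dataComb x N a ω ^ 2, fun ω => dataComb x N c ω ^ 2; P] +
      cov[fun ω => dataComb x N a ω ^ 2, fun ω => dataComb x N d ω ^ 2; P] +
      (cov[fun ω => dataComb x N b ω ^ 2, fun ω => dataComb x N c ω ^ 2; P] +
      cov[fun ω => dataComb x N b ω ^ 2, fun ω => dataComb x N d ω ^ 2; P]) := by
    intro a b c d
    have h := covariance_add_left (i a) (i b) ((i c).add (i d))
    rwa [covariance_add_right (i a) (i c) (i d), covariance_add_right (i b) (i c) (i d)] at h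
  have i4 := memLp_finsetSum (Finset.Icc 1 K) fun k _ => i3 k
  rw [← covariance_self i4.aemeasurable, covariance_fun_sum_left' (fun k _ => i3 k) i4]
  refine Finset.sum_congr rfl fun j _ => ?_
  rw [covariance_fun_sum_right' (fun k _ => i3 k) (i3 j)]
  refine Finset.sum_congr rfl fun k _ => ?_
  rw [covariance_const_mul_left, covariance_const_mul_right,
    hadd]
  simp only [covariance_sq_dataComb hg hx]
  -- In the sum of the two squared moduli the cross terms cancel, leaving twice the sum of the four
  -- squared covariances, which is what Wick's formula produced.
  rw [spectralForm_taperWave_re_im hx hS, spectralForm_taperWave_neg_re_im hx hS,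
    ← Complex.normSq_eq_norm_sq, ← Complex.normSq_eq_norm_sq, Complex.normSq_apply,
    Complex.normSq_apply]
  ring

/-- Reality of the process: the frequencies `f` and `-f` carry the same power. -/
lemma spectralForm_taperWave_neg_neg (hx : HasSpectralDensity x P S) [IsProbabilityMeasure P]
    (hS : ContinuousOn S (Set.Icc (-1 / 2) (1 / 2))) (N : ℕ) (a : ℕ → ℝ) (f : ℝ) :
    (spectralForm S (taperWave N a (-f)) (taperWave N a (-f))).re =
      (spectralForm S (taperWave N a f) (taperWave N a f)).re := by
  have hc : cosComb a (-f) = cosComb a f := by ext n; simp [cosComb]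
  have hs : sinComb a (-f) = fun n => - sinComb a f n := by ext n; simp [sinComb]
  rw [spectralForm_taperWave_re_im hx hS, spectralForm_taperWave_re_im hx hS, hc, hs]
  simp only [covariance_dataComb hx, neg_mul_neg]

end SpectralRepresentation

/-! ### Orthonormality of the sinusoidal tapers and exact trigonometric moments of their windows. -/

section TaperMoments

lemma integral_exp_two_pi_mul_I (n : ℤ) (h : ℝ) :
    ∫ g in (-1 / 2 : ℝ)..(1 / 2), Complex.exp ((2 * Real.pi * n * (g - h) : ℝ) * Complex.I) =
      if n = 0 then 1 else 0 := by
  split_ifs with hn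
  · subst hn; simp; norm_num
  have hc : (2 * Real.pi * n * Complex.I : ℂ) ≠ 0 := by
    simp [hn, Real.pi_ne_zero]
  have h1 : ∀ g : ℝ, Complex.exp ((2 * Real.pi * n * (g - h) : ℝ) * Complex.I) =
      Complex.exp (-(2 * Real.pi * n * Complex.I) * h) *
        Complex.exp ((2 * Real.pi * n * Complex.I) * g) := by
    intro g; rw [← Complex.exp_add]; congr 1; push_cast; ring
  simp_rw [h1]
  rw [intervalIntegral.integral_const_mul, integral_exp_mul_complex hc]
  have h2 : Complex.exp ((2 * Real.pi * n * Complex.I) * ((1 / 2 : ℝ) : ℂ)) =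
      Complex.exp ((2 * Real.pi * n * Complex.I) * ((-1 / 2 : ℝ) : ℂ)) := by
    rw [Complex.exp_eq_exp_iff_exists_int]
    exact ⟨n, by push_cast; ring⟩
  rw [h2]; simp

/-- The character `g ↦ e^{2πin(g-h)}`. -/
noncomputable def waveChar (h : ℝ) (n : ℕ) (g : ℝ) : ℂ :=
  Complex.exp ((2 * Real.pi * n * (g - h) : ℝ) * Complex.I)

lemma continuous_waveChar (h : ℝ) (n : ℕ) : Continuous (waveChar h n) := by
  unfold waveChar; fun_prop

lemma waveChar_add (h : ℝ) (n m : ℕ) (g : ℝ) :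
    waveChar h (n + m) g = waveChar h n g * waveChar h m g := by
  rw [waveChar, waveChar, waveChar, ← Complex.exp_add]; congr 1; push_cast; ring

lemma waveChar_eq_pow (h : ℝ) (n : ℕ) (g : ℝ) : waveChar h n g = waveChar h 1 g ^ n := by
  rw [waveChar, waveChar, ← Complex.exp_nat_mul]; congr 1; push_cast; ring

lemma integral_waveChar_mul_conj (h : ℝ) (n m : ℕ) :
    ∫ g in (-1 / 2 : ℝ)..(1 / 2), waveChar h n g * (starRingEnd ℂ) (waveChar h m g) =
      if n = m then 1 else 0 := by
  have h1 : ∀ g, waveChar h n g * (starRingEnd ℂ) (waveChar h m g) =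
      Complex.exp ((2 * Real.pi * ((n - m : ℤ) : ℝ) * (g - h) : ℝ) * Complex.I) := by
    intro g
    rw [waveChar, waveChar, ← Complex.exp_conj, ← Complex.exp_add]
    congr 1
    simp only [map_mul, Complex.conj_ofReal, Complex.conj_I]
    push_cast; ring
  simp_rw [h1]
  rw [integral_exp_two_pi_mul_I]
  simp [sub_eq_zero]

/-- Parseval's identity for trigonometric polynomials. -/
lemma integral_trigPoly_mul_conj (s : Finset ℕ) (a b : ℕ → ℂ) (h : ℝ) :
    ∫ g in (-1 / 2 : ℝ)..(1 / 2), (∑ n ∈ s, a n * waveChar h n g) *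
      (starRingEnd ℂ) (∑ n ∈ s, b n * waveChar h n g) = ∑ n ∈ s, a n * (starRingEnd ℂ) (b n) := by
  have hc := continuous_waveChar h
  simp_rw [map_sum, map_mul, Finset.sum_mul_sum]
  rw [intervalIntegral.integral_finsetSum fun n _ =>
    Continuous.intervalIntegrable (by fun_prop) _ _]
  refine Finset.sum_congr rfl fun n hn => ?_
  rw [intervalIntegral.integral_finsetSum fun n _ =>
    Continuous.intervalIntegrable (by fun_prop) _ _]
  have h1 : ∀ m ∈ s, ∫ g in (-1 / 2 : ℝ)..(1 / 2), a n * waveChar h n g *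
      ((starRingEnd ℂ) (b m) * (starRingEnd ℂ) (waveChar h m g)) =
      if n = m then a n * (starRingEnd ℂ) (b m) else 0 := by
    intro m _
    have : ∀ g, a n * waveChar h n g * ((starRingEnd ℂ) (b m) * (starRingEnd ℂ) (waveChar h m g)) =
        (a n * (starRingEnd ℂ) (b m)) *
          (waveChar h n g * (starRingEnd ℂ) (waveChar h m g)) := fun g => by ring
    simp_rw [this]
    rw [intervalIntegral.integral_const_mul, integral_waveChar_mul_conj]
    simp
  rw [Finset.sum_congr rfl h1]
  simp [hn]

lemma two_mul_sin_mul_sum_cos (N : ℕ) (y : ℝ) :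
    2 * Real.sin (y / 2) * ∑ n ∈ Finset.Icc 1 N, Real.cos (n * y) =
      Real.sin ((N + 1 / 2) * y) - Real.sin (y / 2) := by
  induction N with
  | zero => simp; ring_nf
  | succ N ih =>
    rw [Finset.sum_Icc_succ_top (by omega), mul_add, ih]
    have h1 : ((N : ℝ) + 1 / 2) * y = (N + 1) * y - y / 2 := by ring
    have h2 : (((N + 1 : ℕ) : ℝ) + 1 / 2) * y = (N + 1) * y + y / 2 := by push_cast; ring
    rw [h1, h2, Real.sin_add, Real.sin_sub]
    push_cast; ring

lemma two_mul_sum_cos_pi_mul (N : ℕ) (l : ℤ) (h0 : l ≠ 0) (hl : |l| < 2 * (N + 1)) :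
    2 * ∑ n ∈ Finset.Icc 1 N, Real.cos (n * (Real.pi * l / (N + 1))) =
      -1 - Real.cos (l * Real.pi) := by
  have hN : (0 : ℝ) < N + 1 := by positivity
  -- The range of `l` excludes the nonzero multiples of `2(N+1)`, so the denominator of the
  -- Dirichlet kernel can be cancelled.
  have hs : Real.sin (Real.pi * l / (N + 1) / 2) ≠ 0 := by
    rw [Ne, Real.sin_eq_zero_iff]
    rintro ⟨m, hm⟩
    have h1 : (m : ℝ) * (2 * (N + 1)) = l := by
      field_simp at hm; linarith
    have h2 : m * (2 * (N + 1)) = l := by exact_mod_cast h1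
    have h3 : m ≠ 0 := by rintro rfl; simp at h2; exact h0 h2.symm
    have h4 : 1 ≤ |m| := Int.one_le_abs h3
    rw [← h2, abs_mul, abs_of_pos (by positivity : (0 : ℤ) < 2 * (N + 1))] at hl
    nlinarith
  have h := two_mul_sin_mul_sum_cos N (Real.pi * l / (N + 1))
  have e : ((N : ℝ) + 1 / 2) * (Real.pi * l / (N + 1)) =
      l * Real.pi - Real.pi * l / (N + 1) / 2 := by field_simp; ring
  rw [e, Real.sin_sub, Real.sin_int_mul_pi] at h
  refine mul_left_cancel₀ hs ?_
  linear_combination h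

/-- The sinusoidal tapers are orthonormal. -/
lemma sum_sinusoidalTaper_mul (N j k : ℕ) (hj : j ∈ Finset.Icc 1 N) (hk : k ∈ Finset.Icc 1 N) :
    ∑ n ∈ Finset.Icc 1 N, sinusoidalTaper N j n * sinusoidalTaper N k n =
      if j = k then 1 else 0 := by
  rw [Finset.mem_Icc] at hj hk
  have hN : (0 : ℝ) < N + 1 := by positivity
  have h1 : ∀ n : ℕ, sinusoidalTaper N j n * sinusoidalTaper N k n = (1 / ((N : ℝ) + 1)) *
      (Real.cos (n * (Real.pi * ((j - k : ℤ)) / (N + 1))) -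
        Real.cos (n * (Real.pi * ((j + k : ℤ)) / (N + 1)))) := by
    intro n
    have e1 : (n : ℝ) * (Real.pi * ((j - k : ℤ)) / (N + 1)) =
      Real.pi * j * n / (N + 1) - Real.pi * k * n / (N + 1) := by push_cast; field_simp
    have e2 : (n : ℝ) * (Real.pi * ((j + k : ℤ)) / (N + 1)) =
      Real.pi * j * n / (N + 1) + Real.pi * k * n / (N + 1) := by push_cast; field_simp
    rw [e1, e2, Real.cos_sub, Real.cos_add, sinusoidalTaper, sinusoidalTaper]
    have := Real.mul_self_sqrt (by positivity : 0 ≤ 2 / ((N : ℝ) + 1))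
    linear_combination (Real.sin (Real.pi * j * n / (N + 1)) *
      Real.sin (Real.pi * k * n / (N + 1))) * this
  simp_rw [h1]
  rw [← Finset.mul_sum, Finset.sum_sub_distrib]
  have hp := two_mul_sum_cos_pi_mul N (j + k) (by omega) (by rw [abs_of_pos] <;> omega)
  split_ifs with hjk
  · subst hjk
    have h2 : ((j + j : ℤ) : ℝ) * Real.pi = (j : ℤ) * (2 * Real.pi) := by push_cast; ring
    rw [h2, Real.cos_int_mul_two_pi] at hp
    have h3 : ∑ n ∈ Finset.Icc 1 N, Real.cos (n * (Real.pi * ((j + j : ℤ) : ℝ) / (N + 1))) = -1 := by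
      linarith
    rw [h3]; simp; field_simp
  · have hm := two_mul_sum_cos_pi_mul N (j - k) (by omega) (by rw [abs_lt]; omega)
    -- `j - k` and `j + k` have the same parity, so the two cosine sums agree and cancel.
    have h2 : Real.cos (((j - k : ℤ) : ℝ) * Real.pi) = Real.cos (((j + k : ℤ) : ℝ) * Real.pi) := by
      push_cast
      rw [sub_mul, add_mul, Real.cos_sub, Real.cos_add, Real.sin_nat_mul_pi]; ring
    rw [h2] at hm
    have : ∀ a b : ℝ, 2 * a = 2 * b → 1 / ((N : ℝ) + 1) * (a - b) = 0 := by
      intro a b hab; rw [show a = b by linarith]; simp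
    exact this _ _ (hm.trans hp.symm)

/-- The discrete Laplacian acts on a solution of `u_{n+2} + u_n = μ u_{n+1}`, `u_0 = 0`,
truncated to `1 ≤ n ≤ N`, as a multiple of the identity plus boundary terms. -/
lemma inv_add_mul_sum_pow (u : ℕ → ℂ) (μ z : ℂ) (hz : z ≠ 0) (h0 : u 0 = 0)
    (hu : ∀ n, u (n + 2) + u n = μ * u (n + 1)) (N : ℕ) :
    (z + z⁻¹) * ∑ n ∈ Finset.Icc 1 N, u n * z ^ n =
      μ * ∑ n ∈ Finset.Icc 1 N, u n * z ^ n + u 1 + u N * z ^ (N + 1) - u (N + 1) * z ^ N := by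
  induction N with
  | zero => simp [h0]
  | succ N ih =>
    rw [Finset.sum_Icc_succ_top (by omega), mul_add, ih]
    have h1 := hu N
    have h2 : (z + z⁻¹) * (u (N + 1) * z ^ (N + 1)) = u (N + 1) * (z ^ (N + 2) + z ^ N) := by
      field_simp; ring
    rw [h2]
    linear_combination (z ^ (N + 1)) * h1

lemma sinusoidalTaper_zero (N k : ℕ) : sinusoidalTaper N k 0 = 0 := by simp [sinusoidalTaper]

lemma sinusoidalTaper_succ_length (N k : ℕ) : sinusoidalTaper N k (N + 1) = 0 := by
  have : Real.pi * k * ((N + 1 : ℕ) : ℝ) / (N + 1) = k * Real.pi := by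
    push_cast; field_simp
  rw [sinusoidalTaper, this, Real.sin_nat_mul_pi, mul_zero]

lemma sinusoidalTaper_rec (N k n : ℕ) : sinusoidalTaper N k (n + 2) + sinusoidalTaper N k n =
    2 * Real.cos (Real.pi * k / (N + 1)) * sinusoidalTaper N k (n + 1) := by
  have h1 : Real.pi * k * ((n + 2 : ℕ) : ℝ) / (N + 1) =
      Real.pi * k * ((n + 1 : ℕ) : ℝ) / (N + 1) + Real.pi * k / (N + 1) := by push_cast; ring
  have h2 : Real.pi * k * (n : ℝ) / (N + 1) =
      Real.pi * k * ((n + 1 : ℕ) : ℝ) / (N + 1) - Real.pi * k / (N + 1) := by push_cast; ring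
  rw [sinusoidalTaper, sinusoidalTaper, sinusoidalTaper, h1, h2, Real.sin_add, Real.sin_sub]
  ring

lemma taperWave_eq_sum_waveChar (N : ℕ) (u : ℕ → ℝ) (h g : ℝ) :
    taperWave N u h g = ∑ n ∈ Finset.Icc 1 N, (u n : ℂ) * waveChar h n g := rfl

/-- `sin²(πk/(2(N+1)))`: a quarter of the `k`-th eigenvalue of the Dirichlet Laplacian. -/
noncomputable def taperBand (N k : ℕ) : ℝ := Real.sin (Real.pi * k / (2 * (N + 1))) ^ 2

/-- With `z = e^{2πi(g-h)}`, the factor `4 sin²(π(g-h)) = 2 - z - z⁻¹` acts on coefficients as the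
discrete Laplacian. The taper is an eigenvector vanishing at `0` and `N + 1`; truncation only leaves
terms at these two sites. -/
lemma four_sin_sq_mul_taperWave (N k : ℕ) (h g : ℝ) :
    ((4 * Real.sin (Real.pi * (g - h)) ^ 2 : ℝ) : ℂ) * taperWave N (sinusoidalTaper N k) h g =
      ((4 * taperBand N k : ℝ) : ℂ) * taperWave N (sinusoidalTaper N k) h g
        - sinusoidalTaper N k 1 * waveChar h 0 g
        - sinusoidalTaper N k N * waveChar h (N + 1) g := by
  have hz : waveChar h 1 g ≠ 0 := Complex.exp_ne_zero _
  have key := inv_add_mul_sum_pow (fun n => (sinusoidalTaper N k n : ℂ))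
    (2 * Real.cos (Real.pi * k / (N + 1)) : ℝ) (waveChar h 1 g) hz
    (by simp [sinusoidalTaper_zero])
    (fun n => by exact_mod_cast sinusoidalTaper_rec N k n) N
  simp only [sinusoidalTaper_succ_length] at key
  have e1 : ∀ θ : ℝ, 4 * Real.sin θ ^ 2 = 2 - 2 * Real.cos (2 * θ) := by
    intro θ; rw [Real.cos_two_mul, Real.sin_sq]; ring
  have e2 : (waveChar h 1 g) + (waveChar h 1 g)⁻¹ =
      ((2 * Real.cos (2 * (Real.pi * (g - h))) : ℝ) : ℂ) := by
    rw [waveChar, ← Complex.exp_neg]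
    push_cast
    rw [Complex.cos]
    have : (2 * (Real.pi : ℂ) * 1 * ((g : ℂ) - h) * Complex.I) =
      2 * (Real.pi * ((g : ℂ) - h)) * Complex.I := by ring
    rw [this, ← neg_mul]; ring
  have e3 : 4 * taperBand N k = 2 - 2 * Real.cos (Real.pi * k / (N + 1)) := by
    rw [taperBand, e1]; congr 3; field_simp
  have e4 : taperWave N (sinusoidalTaper N k) h g =
      ∑ n ∈ Finset.Icc 1 N, (sinusoidalTaper N k n : ℂ) * waveChar h 1 g ^ n :=
    Finset.sum_congr rfl fun n _ => by rw [← waveChar_eq_pow]; rfl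
  rw [e1, e3, e4, waveChar_eq_pow h 0, waveChar_eq_pow h (N + 1)]
  rw [e2] at key
  push_cast at key ⊢
  linear_combination -key

/-- Including the sites `0` and `N + 1`, where the taper vanishes, puts the wave and its Laplacian
on the same index set for Parseval's identity. -/
lemma taperWave_eq_sum_range (N k : ℕ) (h g : ℝ) :
    taperWave N (sinusoidalTaper N k) h g =
      ∑ n ∈ Finset.range (N + 2), (sinusoidalTaper N k n : ℂ) * waveChar h n g := by
  rw [taperWave_eq_sum_waveChar]
  refine Finset.sum_subset (fun n hn => ?_) fun n hn hn' => ?_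
  · simp only [Finset.mem_Icc, Finset.mem_range] at *; omega
  · have : n = 0 ∨ n = N + 1 := by simp only [Finset.mem_Icc, Finset.mem_range] at *; omega
    rcases this with rfl | rfl
    · simp [sinusoidalTaper_zero]
    · simp [sinusoidalTaper_succ_length]

/-- The coefficients of `4 sin²(π(g-h))` times the `k`-th taper wave. -/
noncomputable def laplaceCoeff (N k n : ℕ) : ℝ :=
  4 * taperBand N k * sinusoidalTaper N k n - (if n = 0 then sinusoidalTaper N k 1 else 0)
    - (if n = N + 1 then sinusoidalTaper N k N else 0)

lemma four_sin_sq_mul_taperWave_eq_sum (N k : ℕ) (h g : ℝ) :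
    ((4 * Real.sin (Real.pi * (g - h)) ^ 2 : ℝ) : ℂ) * taperWave N (sinusoidalTaper N k) h g =
      ∑ n ∈ Finset.range (N + 2), (laplaceCoeff N k n : ℂ) * waveChar h n g := by
  rw [four_sin_sq_mul_taperWave, taperWave_eq_sum_range]
  simp only [laplaceCoeff, Complex.ofReal_sub, sub_mul, Finset.sum_sub_distrib, apply_ite
    Complex.ofReal, Complex.ofReal_zero, ite_mul, zero_mul, Finset.sum_ite_eq',
    Finset.mul_sum]
  simp only [Finset.mem_range, show 0 < N + 2 by omega, show N + 1 < N + 2 by omega, if_true]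
  push_cast
  simp only [mul_assoc]

lemma sum_sinusoidalTaper_mul_range (N j k : ℕ) (hj : j ∈ Finset.Icc 1 N)
    (hk : k ∈ Finset.Icc 1 N) : ∑ n ∈ Finset.range (N + 2),
      sinusoidalTaper N j n * sinusoidalTaper N k n = if j = k then 1 else 0 := by
  rw [← sum_sinusoidalTaper_mul N j k hj hk]
  symm
  refine Finset.sum_subset (fun n hn => ?_) fun n hn hn' => ?_
  · simp only [Finset.mem_Icc, Finset.mem_range] at *; omega
  · have : n = 0 ∨ n = N + 1 := by simp only [Finset.mem_Icc, Finset.mem_range] at *; omega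
    rcases this with rfl | rfl
    · simp [sinusoidalTaper_zero]
    · simp [sinusoidalTaper_succ_length]

/-- The boundary terms sit exactly where the tapers vanish, so they drop out of the pairing and the
result is exactly diagonal. -/
lemma sum_laplaceCoeff_mul_sinusoidalTaper (N j k : ℕ) (hj : j ∈ Finset.Icc 1 N)
    (hk : k ∈ Finset.Icc 1 N) : ∑ n ∈ Finset.range (N + 2),
      laplaceCoeff N j n * sinusoidalTaper N k n = if j = k then 4 * taperBand N k else 0 := by
  have h := sum_sinusoidalTaper_mul_range N j k hj hk
  simp only [laplaceCoeff, sub_mul, Finset.sum_sub_distrib, ite_mul, zero_mul, Finset.sum_ite_eq',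
    sinusoidalTaper_zero, sinusoidalTaper_succ_length, mul_zero, ite_self, sub_zero]
  simp only [mul_assoc, ← Finset.mul_sum, h]
  split_ifs with hjk
  · rw [hjk]; ring
  · ring

lemma sum_laplaceCoeff_sq (N k : ℕ) (hk : k ∈ Finset.Icc 1 N) :
    ∑ n ∈ Finset.range (N + 2), laplaceCoeff N k n * laplaceCoeff N k n =
      16 * taperBand N k ^ 2 + sinusoidalTaper N k 1 ^ 2 + sinusoidalTaper N k N ^ 2 := by
  have h := sum_laplaceCoeff_mul_sinusoidalTaper N k k hk hk
  rw [if_pos rfl] at h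
  have h1 : ∀ n, laplaceCoeff N k n * laplaceCoeff N k n =
      (4 * taperBand N k) * (laplaceCoeff N k n * sinusoidalTaper N k n)
        - (if n = 0 then laplaceCoeff N k n * sinusoidalTaper N k 1 else 0)
        - (if n = N + 1 then laplaceCoeff N k n * sinusoidalTaper N k N else 0) := by
    intro n
    simp only [laplaceCoeff]
    split_ifs <;> ring
  simp only [h1, Finset.sum_sub_distrib, ← Finset.mul_sum, h, Finset.sum_ite_eq']
  simp [laplaceCoeff, sinusoidalTaper_zero, sinusoidalTaper_succ_length]
  ring

lemma sinusoidalTaper_one_sq_le (N k : ℕ) :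
    sinusoidalTaper N k 1 ^ 2 ≤ 8 * taperBand N k / (N + 1) := by
  have h1 : Real.pi * k * ((1 : ℕ) : ℝ) / (N + 1) = 2 * (Real.pi * k / (2 * (N + 1))) := by
    push_cast; field_simp
  rw [sinusoidalTaper, mul_pow, Real.sq_sqrt (by positivity), h1, Real.sin_two_mul, taperBand]
  set θ := Real.pi * k / (2 * ((N : ℝ) + 1))
  have h2 : (2 * Real.sin θ * Real.cos θ) ^ 2 ≤ 4 * Real.sin θ ^ 2 := by
    nlinarith [Real.sin_sq_add_cos_sq θ, sq_nonneg (Real.sin θ), sq_nonneg (Real.sin θ ^ 2)]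
  calc 2 / ((N : ℝ) + 1) * (2 * Real.sin θ * Real.cos θ) ^ 2
      ≤ 2 / ((N : ℝ) + 1) * (4 * Real.sin θ ^ 2) := by gcongr
    _ = _ := by ring

/-- Up to sign, a taper is symmetric under `n ↦ N + 1 - n`. -/
lemma sinusoidalTaper_last_sq (N k : ℕ) :
    sinusoidalTaper N k N ^ 2 = sinusoidalTaper N k 1 ^ 2 := by
  have h1 : Real.pi * k * (N : ℝ) / (N + 1) =
      k * Real.pi - Real.pi * k * ((1 : ℕ) : ℝ) / (N + 1) := by push_cast; field_simp; ring
  rw [sinusoidalTaper, sinusoidalTaper, h1, Real.sin_sub, Real.sin_nat_mul_pi, mul_pow, mul_pow]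
  congr 1
  have := Real.sin_sq_add_cos_sq ((k : ℝ) * Real.pi)
  rw [Real.sin_nat_mul_pi] at this
  linear_combination (Real.sin (Real.pi * k * ((1 : ℕ) : ℝ) / (N + 1)) ^ 2) * this

lemma integral_taperWave_mul_conj (N j k : ℕ) (hj : j ∈ Finset.Icc 1 N)
    (hk : k ∈ Finset.Icc 1 N) (h : ℝ) :
    ∫ g in (-1 / 2 : ℝ)..(1 / 2), taperWave N (sinusoidalTaper N j) h g *
      (starRingEnd ℂ) (taperWave N (sinusoidalTaper N k) h g) = if j = k then 1 else 0 := by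
  simp only [taperWave_eq_sum_waveChar]
  rw [integral_trigPoly_mul_conj]
  have := sum_sinusoidalTaper_mul N j k hj hk
  simp only [Complex.conj_ofReal, ← Complex.ofReal_mul, ← Complex.ofReal_sum, this]
  split_ifs <;> simp

lemma integral_sin_sq_mul_taperWave_mul_conj (N j k : ℕ) (hj : j ∈ Finset.Icc 1 N)
    (hk : k ∈ Finset.Icc 1 N) (h : ℝ) :
    ∫ g in (-1 / 2 : ℝ)..(1 / 2), ((Real.sin (Real.pi * (g - h)) ^ 2 : ℝ) : ℂ) *
      (taperWave N (sinusoidalTaper N j) h g *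
      (starRingEnd ℂ) (taperWave N (sinusoidalTaper N k) h g)) =
        if j = k then (taperBand N k : ℂ) else 0 := by
  have h1 : ∀ g, ((Real.sin (Real.pi * (g - h)) ^ 2 : ℝ) : ℂ) *
      (taperWave N (sinusoidalTaper N j) h g *
      (starRingEnd ℂ) (taperWave N (sinusoidalTaper N k) h g)) = (1 / 4 : ℂ) *
      ((∑ n ∈ Finset.range (N + 2), (laplaceCoeff N j n : ℂ) * waveChar h n g) *
      (starRingEnd ℂ) (∑ n ∈ Finset.range (N + 2),
        (sinusoidalTaper N k n : ℂ) * waveChar h n g)) := by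
    intro g
    rw [← four_sin_sq_mul_taperWave_eq_sum, ← taperWave_eq_sum_range]
    push_cast; ring
  simp_rw [h1]
  rw [intervalIntegral.integral_const_mul, integral_trigPoly_mul_conj]
  simp only [Complex.conj_ofReal, ← Complex.ofReal_mul, ← Complex.ofReal_sum,
    sum_laplaceCoeff_mul_sinusoidalTaper N j k hj hk]
  split_ifs
  · push_cast; ring
  · simp

lemma integral_norm_sq_taperWave (N k : ℕ) (hk : k ∈ Finset.Icc 1 N) (h : ℝ) :
    ∫ g in (-1 / 2 : ℝ)..(1 / 2), ‖taperWave N (sinusoidalTaper N k) h g‖ ^ 2 = 1 := by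
  have := integral_taperWave_mul_conj N k k hk hk h
  simp_rw [Complex.mul_conj, Complex.normSq_eq_norm_sq] at this
  rw [intervalIntegral.integral_ofReal] at this
  rw [if_pos trivial] at this
  exact Complex.ofReal_injective (this.trans Complex.ofReal_one.symm)

lemma integral_sin_sq_mul_norm_sq_taperWave (N k : ℕ) (hk : k ∈ Finset.Icc 1 N) (h : ℝ) :
    ∫ g in (-1 / 2 : ℝ)..(1 / 2), Real.sin (Real.pi * (g - h)) ^ 2 *
      ‖taperWave N (sinusoidalTaper N k) h g‖ ^ 2 = taperBand N k := by
  have := integral_sin_sq_mul_taperWave_mul_conj N k k hk hk h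
  simp_rw [Complex.mul_conj, Complex.normSq_eq_norm_sq, ← Complex.ofReal_mul] at this
  rw [intervalIntegral.integral_ofReal, if_pos trivial] at this
  exact Complex.ofReal_injective this

/-- This is Parseval for the Laplacian of the taper with itself. Here the boundary terms survive;
being equal, they add `2 v_1²/16`, which is the second summand of the bound. -/
lemma integral_sin_pow_four_mul_norm_sq_taperWave_le (N k : ℕ) (hk : k ∈ Finset.Icc 1 N) (h : ℝ) :
    ∫ g in (-1 / 2 : ℝ)..(1 / 2), Real.sin (Real.pi * (g - h)) ^ 4 *
      ‖taperWave N (sinusoidalTaper N k) h g‖ ^ 2 ≤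
        taperBand N k ^ 2 + taperBand N k / (N + 1) := by
  have h1 := integral_trigPoly_mul_conj (Finset.range (N + 2)) (fun n => (laplaceCoeff N k n : ℂ))
    (fun n => (laplaceCoeff N k n : ℂ)) h
  simp only [Complex.conj_ofReal, ← Complex.ofReal_mul, ← Complex.ofReal_sum,
    ← four_sin_sq_mul_taperWave_eq_sum, sum_laplaceCoeff_sq N k hk] at h1
  have h2 : ∀ g, ‖((4 * Real.sin (Real.pi * (g - h)) ^ 2 : ℝ) : ℂ) *
      taperWave N (sinusoidalTaper N k) h g‖ ^ 2 = 16 * (Real.sin (Real.pi * (g - h)) ^ 4 *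
      ‖taperWave N (sinusoidalTaper N k) h g‖ ^ 2) := by
    intro g
    rw [norm_mul, mul_pow, Complex.norm_real, Real.norm_eq_abs, sq_abs]; ring
  simp_rw [Complex.mul_conj, Complex.normSq_eq_norm_sq, h2] at h1
  rw [intervalIntegral.integral_ofReal] at h1
  have h3 := Complex.ofReal_injective h1
  rw [intervalIntegral.integral_const_mul, sinusoidalTaper_last_sq] at h3
  have h4 := sinusoidalTaper_one_sq_le N k
  have h5 : 8 * taperBand N k / (N + 1) = 8 * (taperBand N k / (N + 1)) := by ring
  linarith

/-- The spectral window of a real taper is even. -/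
lemma integral_sin_mul_norm_sq_taperWave (N : ℕ) (u : ℕ → ℝ) (h : ℝ) :
    ∫ g in (-1 / 2 : ℝ)..(1 / 2), Real.sin (2 * Real.pi * (g - h)) *
      ‖taperWave N u h g‖ ^ 2 = 0 := by
  have hc := continuous_taperWave N u h
  have hw := continuous_waveChar h 1
  have h0 : ∀ g, Real.sin (2 * Real.pi * (g - h)) * ‖taperWave N u h g‖ ^ 2 =
      (waveChar h 1 g * taperWave N u h g * (starRingEnd ℂ) (taperWave N u h g)).im := by
    intro g
    rw [mul_assoc (waveChar h 1 g), Complex.mul_conj, Complex.im_mul_ofReal, waveChar, Complex.exp_ofReal_mul_I_im,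
      Complex.normSq_eq_norm_sq]
    simp
  have h1 : ∀ g, waveChar h 1 g * taperWave N u h g =
      ∑ n ∈ Finset.range (N + 2),
        (if n ∈ Finset.Icc 2 (N + 1) then (u (n - 1) : ℂ) else 0) * waveChar h n g := by
    intro g
    rw [taperWave_eq_sum_waveChar, Finset.mul_sum]
    simp only [ite_mul, zero_mul]
    rw [← Finset.sum_filter]
    refine Finset.sum_nbij' (fun n => n + 1) (fun n => n - 1) ?_ ?_ ?_ ?_ ?_
    · intro n hn; simp only [Finset.mem_Icc, Finset.mem_filter, Finset.mem_range] at *; omega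
    · intro n hn; simp only [Finset.mem_Icc, Finset.mem_filter, Finset.mem_range] at *; omega
    · intro n hn; simp
    · intro n hn; simp only [Finset.mem_Icc, Finset.mem_filter, Finset.mem_range] at *; omega
    · intro n hn; rw [waveChar_add]; simp; ring
  have h2 : ∀ g, taperWave N u h g = ∑ n ∈ Finset.range (N + 2),
        (if n ∈ Finset.Icc 1 N then (u n : ℂ) else 0) * waveChar h n g := by
    intro g
    rw [taperWave_eq_sum_waveChar]
    simp only [ite_mul, zero_mul]
    rw [← Finset.sum_filter]
    congr 1; ext n; simp only [Finset.mem_Icc, Finset.mem_filter, Finset.mem_range]; omega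
  -- By Parseval the integral is the lag-one autocorrelation of a real sequence, hence real.
  have h3 : (∫ g in (-1 / 2 : ℝ)..(1 / 2),
      waveChar h 1 g * taperWave N u h g * (starRingEnd ℂ) (taperWave N u h g)).im = 0 := by
    simp_rw [h1]
    simp_rw [h2]
    rw [integral_trigPoly_mul_conj, Complex.im_sum]
    refine Finset.sum_eq_zero fun n _ => ?_
    split_ifs <;> simp
  simp_rw [h0]
  have hi : IntervalIntegrable (fun g => waveChar h 1 g * taperWave N u h g *
      (starRingEnd ℂ) (taperWave N u h g)) volume (-1 / 2) (1 / 2) :=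
    Continuous.intervalIntegrable (by fun_prop) _ _
  rw [← h3]
  exact Complex.imCLM.intervalIntegral_comp_comm hi

lemma taperBand_nonneg (N k : ℕ) : 0 ≤ taperBand N k := sq_nonneg _

lemma taperBand_le (N k : ℕ) : taperBand N k ≤ (Real.pi * k / (2 * (N + 1))) ^ 2 := by
  rw [taperBand, sq_le_sq, abs_of_nonneg (by positivity : 0 ≤ Real.pi * k / (2 * ((N : ℝ) + 1)))]
  exact (Real.abs_sin_le_abs).trans_eq (abs_of_nonneg (by positivity))

end TaperMoments

/-! ### Cauchy-Schwarz and Bessel inequalities for the spectral form. -/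

section SpectralFormInequalities

local notation "freqs" => Set.Icc (-1 / 2 : ℝ) (1 / 2)

lemma ContinuousOn.intervalIntegrable_freqs {E : Type*} [NormedAddCommGroup E] {φ : ℝ → E}
    (hφ : ContinuousOn φ freqs) : IntervalIntegrable φ volume (-1 / 2) (1 / 2) :=
  ContinuousOn.intervalIntegrable (by rwa [Set.uIcc_of_le (by norm_num)])

lemma continuousOn_ofReal_mul {φ : ℝ → ℝ} {F G : ℝ → ℂ} (hφ : ContinuousOn φ freqs)
    (hF : Continuous F) (hG : Continuous G) :
    ContinuousOn (fun g => (φ g : ℂ) * (F g * (starRingEnd ℂ) (G g))) freqs :=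
  (Complex.continuous_ofReal.comp_continuousOn hφ).mul (by fun_prop)

lemma integral_freqs_mono {φ ψ : ℝ → ℝ} (hφ : ContinuousOn φ freqs) (hψ : ContinuousOn ψ freqs)
    (h : ∀ g ∈ freqs, φ g ≤ ψ g) :
    ∫ g in (-1 / 2 : ℝ)..(1 / 2), φ g ≤ ∫ g in (-1 / 2 : ℝ)..(1 / 2), ψ g :=
  intervalIntegral.integral_mono_on (by norm_num) hφ.intervalIntegrable_freqs
    hψ.intervalIntegrable_freqs h

lemma integral_freqs_nonneg {φ : ℝ → ℝ} (h : ∀ g ∈ freqs, 0 ≤ φ g) :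
    0 ≤ ∫ g in (-1 / 2 : ℝ)..(1 / 2), φ g :=
  intervalIntegral.integral_nonneg (by norm_num) h

lemma integral_freqs_conj (F : ℝ → ℂ) :
    (starRingEnd ℂ) (∫ g in (-1 / 2 : ℝ)..(1 / 2), F g) =
      ∫ g in (-1 / 2 : ℝ)..(1 / 2), (starRingEnd ℂ) (F g) := by
  rw [intervalIntegral.integral_of_le (by norm_num),
    intervalIntegral.integral_of_le (by norm_num), integral_conj]

lemma spectralForm_add {φ ψ : ℝ → ℝ} {F G : ℝ → ℂ} (hφ : ContinuousOn φ freqs)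
    (hψ : ContinuousOn ψ freqs) (hF : Continuous F) (hG : Continuous G) :
    spectralForm (fun g => φ g + ψ g) F G = spectralForm φ F G + spectralForm ψ F G := by
  unfold spectralForm
  rw [← intervalIntegral.integral_add
    (continuousOn_ofReal_mul hφ hF hG).intervalIntegrable_freqs
    (continuousOn_ofReal_mul hψ hF hG).intervalIntegrable_freqs]
  congr 1; ext g; push_cast; ring

lemma spectralForm_const_mul (c : ℝ) (φ : ℝ → ℝ) (F G : ℝ → ℂ) :
    spectralForm (fun g => c * φ g) F G = c * spectralForm φ F G := by
  unfold spectralForm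
  rw [← intervalIntegral.integral_const_mul]
  congr 1; ext g; push_cast; ring

lemma spectralForm_conj (φ : ℝ → ℝ) (F G : ℝ → ℂ) :
    (starRingEnd ℂ) (spectralForm φ F G) = spectralForm φ G F := by
  unfold spectralForm
  rw [integral_freqs_conj]
  congr 1; ext g; simp [mul_comm]

lemma spectralForm_self (φ : ℝ → ℝ) (F : ℝ → ℂ) :
    spectralForm φ F F = ((∫ g in (-1 / 2 : ℝ)..(1 / 2), φ g * ‖F g‖ ^ 2 : ℝ) : ℂ) := by
  unfold spectralForm
  simp_rw [Complex.mul_conj, Complex.normSq_eq_norm_sq, ← Complex.ofReal_mul]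
  exact intervalIntegral.integral_ofReal

/-- Weighted Cauchy-Schwarz inequality. -/
lemma norm_sq_spectralForm_le {φ p q : ℝ → ℝ} {F G : ℝ → ℂ} (hφ : ContinuousOn φ freqs)
    (hp : ContinuousOn p freqs) (hq : ContinuousOn q freqs) (hF : Continuous F)
    (hG : Continuous G) (hp0 : ∀ g ∈ freqs, 0 ≤ p g) (hq0 : ∀ g ∈ freqs, 0 ≤ q g)
    (h : ∀ g ∈ freqs, φ g ^ 2 ≤ p g * q g) :
    ‖spectralForm φ F G‖ ^ 2 ≤ (∫ g in (-1 / 2 : ℝ)..(1 / 2), p g * ‖F g‖ ^ 2) *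
      ∫ g in (-1 / 2 : ℝ)..(1 / 2), q g * ‖G g‖ ^ 2 := by
  set X := ∫ g in (-1 / 2 : ℝ)..(1 / 2), p g * ‖F g‖ ^ 2
  set Y := ∫ g in (-1 / 2 : ℝ)..(1 / 2), q g * ‖G g‖ ^ 2
  set Z := ∫ g in (-1 / 2 : ℝ)..(1 / 2), |φ g| * (‖F g‖ * ‖G g‖)
  have cX : ContinuousOn (fun g => p g * ‖F g‖ ^ 2) freqs := hp.mul (by fun_prop)
  have cY : ContinuousOn (fun g => q g * ‖G g‖ ^ 2) freqs := hq.mul (by fun_prop)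
  have cZ : ContinuousOn (fun g => |φ g| * (‖F g‖ * ‖G g‖)) freqs := hφ.abs.mul (by fun_prop)
  have h1 : ‖spectralForm φ F G‖ ≤ Z := by
    refine (intervalIntegral.norm_integral_le_integral_norm (by norm_num)).trans_eq ?_
    congr 1; ext g; simp
  -- The integrand is pointwise at least `(|t| √p ‖F‖ - √q ‖G‖)²`; nonpositivity of the discriminant
  -- then gives `Z² ≤ X Y`.
  have h2 : ∀ t : ℝ, 0 ≤ X * (t * t) + (-2 * Z) * t + Y := by
    intro t
    have e : X * (t * t) + (-2 * Z) * t + Y = ∫ g in (-1 / 2 : ℝ)..(1 / 2),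
        ((t * t) * (p g * ‖F g‖ ^ 2) + (-2 * t) * (|φ g| * (‖F g‖ * ‖G g‖)) +
          q g * ‖G g‖ ^ 2) := by
      have i1 : IntervalIntegrable (fun g => (t * t) * (p g * ‖F g‖ ^ 2)) volume (-1 / 2) (1 / 2) :=
        cX.intervalIntegrable_freqs.const_mul _
      have i2 : IntervalIntegrable (fun g => (-2 * t) * (|φ g| * (‖F g‖ * ‖G g‖))) volume
        (-1 / 2) (1 / 2) := cZ.intervalIntegrable_freqs.const_mul _
      have i3 : IntervalIntegrable (fun g => (t * t) * (p g * ‖F g‖ ^ 2) +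
        (-2 * t) * (|φ g| * (‖F g‖ * ‖G g‖))) volume (-1 / 2) (1 / 2) := i1.add i2
      rw [intervalIntegral.integral_add i3 cY.intervalIntegrable_freqs,
        intervalIntegral.integral_add i1 i2]
      simp only [intervalIntegral.integral_const_mul]
      ring
    rw [e]
    refine integral_freqs_nonneg fun g hg => ?_
    have a1 : |φ g| ≤ Real.sqrt (p g) * Real.sqrt (q g) := by
      rw [← Real.sqrt_mul (hp0 g hg)]
      exact Real.abs_le_sqrt (h g hg)
    have a2 := Real.sq_sqrt (hp0 g hg)
    have a3 := Real.sq_sqrt (hq0 g hg)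
    have a4 : t * (|φ g| * (‖F g‖ * ‖G g‖)) ≤
        |t| * ((Real.sqrt (p g) * Real.sqrt (q g)) * (‖F g‖ * ‖G g‖)) := by
      gcongr; exact le_abs_self t
    have a5 := sq_nonneg (|t| * Real.sqrt (p g) * ‖F g‖ - Real.sqrt (q g) * ‖G g‖)
    have a6 : (|t| * Real.sqrt (p g) * ‖F g‖ - Real.sqrt (q g) * ‖G g‖) ^ 2 =
        (t * t) * (p g * ‖F g‖ ^ 2) + q g * ‖G g‖ ^ 2 -
        2 * (|t| * ((Real.sqrt (p g) * Real.sqrt (q g)) * (‖F g‖ * ‖G g‖))) := by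
      rw [sub_sq, mul_pow, mul_pow, mul_pow, a2, a3, sq_abs]; ring
    linarith
  have h3 := discrim_le_zero h2
  rw [discrim] at h3
  have h4 : ‖spectralForm φ F G‖ ^ 2 ≤ Z ^ 2 := by gcongr
  nlinarith

/-- Bessel's inequality for an orthonormal family of continuous functions. -/
lemma sum_norm_sq_spectralForm_le {ι : Type*} (s : Finset ι) (U : ι → ℝ → ℂ)
    (hU : ∀ k, Continuous (U k)) (horth : ∀ j ∈ s, ∀ k ∈ s, ∫ g in (-1 / 2 : ℝ)..(1 / 2),
      U j g * (starRingEnd ℂ) (U k g) = open Classical in if j = k then 1 else 0)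
    {φ : ℝ → ℝ} (hφ : ContinuousOn φ freqs) {F : ℝ → ℂ} (hF : Continuous F) :
    ∑ k ∈ s, ‖spectralForm φ F (U k)‖ ^ 2 ≤
      ∫ g in (-1 / 2 : ℝ)..(1 / 2), φ g ^ 2 * ‖F g‖ ^ 2 := by
  classical
  -- The weight is absorbed into the first function: `c k` are the unweighted coefficients of `A = φ
  -- F`, and `B` is the orthogonal projection of `A`. The claim is `0 ≤ ∫ |A - B|²`.
  set c : ι → ℂ := fun k => spectralForm φ F (U k)
  set A : ℝ → ℂ := fun g => φ g * F g
  set B : ℝ → ℂ := fun g => ∑ k ∈ s, c k * U k g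
  have hA : ContinuousOn A freqs :=
    (Complex.continuous_ofReal.comp_continuousOn hφ).mul hF.continuousOn
  have hB : Continuous B := by fun_prop
  have hAc : ContinuousOn (fun g => (starRingEnd ℂ) (A g)) freqs :=
    Complex.continuous_conj.comp_continuousOn hA
  have iAB : ∫ g in (-1 / 2 : ℝ)..(1 / 2), A g * (starRingEnd ℂ) (B g) =
      ((∑ k ∈ s, ‖c k‖ ^ 2 : ℝ) : ℂ) := by
    simp only [B, map_sum, map_mul, Finset.mul_sum]
    rw [intervalIntegral.integral_finsetSum]
    · push_cast
      refine Finset.sum_congr rfl fun k _ => ?_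
      rw [← Complex.conj_mul']
      simp only [c, spectralForm]
      rw [← intervalIntegral.integral_const_mul]
      refine intervalIntegral.integral_congr fun g _ => ?_
      simp only [A]; ring
    · intro k _
      exact (hA.mul (by fun_prop)).intervalIntegrable_freqs
  have iBB : ∫ g in (-1 / 2 : ℝ)..(1 / 2), B g * (starRingEnd ℂ) (B g) =
      ((∑ k ∈ s, ‖c k‖ ^ 2 : ℝ) : ℂ) := by
    simp only [B, map_sum, map_mul, Finset.sum_mul_sum]
    rw [intervalIntegral.integral_finsetSum fun n _ =>
      Continuous.intervalIntegrable (by fun_prop) _ _]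
    push_cast
    refine Finset.sum_congr rfl fun j hj => ?_
    rw [intervalIntegral.integral_finsetSum fun n _ =>
      Continuous.intervalIntegrable (by fun_prop) _ _]
    have : ∀ k ∈ s, ∫ g in (-1 / 2 : ℝ)..(1 / 2),
        c j * U j g * ((starRingEnd ℂ) (c k) * (starRingEnd ℂ) (U k g)) =
        if j = k then c j * (starRingEnd ℂ) (c k) else 0 := by
      intro k hk
      have e : ∀ g, c j * U j g * ((starRingEnd ℂ) (c k) * (starRingEnd ℂ) (U k g)) =
        (c j * (starRingEnd ℂ) (c k)) * (U j g * (starRingEnd ℂ) (U k g)) := fun g => by ring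
      simp_rw [e]
      rw [intervalIntegral.integral_const_mul, horth j hj k hk]
      simp
    rw [Finset.sum_congr rfl this, Finset.sum_ite_eq, if_pos hj, Complex.mul_conj']
  have iBA : ∫ g in (-1 / 2 : ℝ)..(1 / 2), B g * (starRingEnd ℂ) (A g) =
      ((∑ k ∈ s, ‖c k‖ ^ 2 : ℝ) : ℂ) := by
    rw [← Complex.conj_ofReal, ← iAB, integral_freqs_conj]
    refine intervalIntegral.integral_congr fun g _ => ?_
    simp [mul_comm]
  have iAA : ∫ g in (-1 / 2 : ℝ)..(1 / 2), A g * (starRingEnd ℂ) (A g) =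
      ((∫ g in (-1 / 2 : ℝ)..(1 / 2), φ g ^ 2 * ‖F g‖ ^ 2 : ℝ) : ℂ) := by
    rw [← intervalIntegral.integral_ofReal]
    refine intervalIntegral.integral_congr fun g _ => ?_
    simp only [A, Complex.mul_conj']
    rw [norm_mul, Complex.norm_real, Real.norm_eq_abs, ← Complex.ofReal_pow, mul_pow, sq_abs]
  have key : ((∫ g in (-1 / 2 : ℝ)..(1 / 2), ‖A g - B g‖ ^ 2 : ℝ) : ℂ) =
      ((∫ g in (-1 / 2 : ℝ)..(1 / 2), φ g ^ 2 * ‖F g‖ ^ 2 : ℝ) : ℂ) -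
        ((∑ k ∈ s, ‖c k‖ ^ 2 : ℝ) : ℂ) := by
    have j1 : IntervalIntegrable (fun g => A g * (starRingEnd ℂ) (A g)) volume (-1 / 2) (1 / 2) :=
      (hA.mul hAc).intervalIntegrable_freqs
    have j2 : IntervalIntegrable (fun g => A g * (starRingEnd ℂ) (B g)) volume (-1 / 2) (1 / 2) :=
      (hA.mul (by fun_prop)).intervalIntegrable_freqs
    have j3 : IntervalIntegrable (fun g => B g * (starRingEnd ℂ) (A g)) volume (-1 / 2) (1 / 2) :=
      (hB.continuousOn.mul hAc).intervalIntegrable_freqs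
    have j4 : IntervalIntegrable (fun g => B g * (starRingEnd ℂ) (B g)) volume (-1 / 2) (1 / 2) :=
      Continuous.intervalIntegrable (by fun_prop) _ _
    have : ∀ g, ((‖A g - B g‖ ^ 2 : ℝ) : ℂ) = (A g * (starRingEnd ℂ) (A g) -
      A g * (starRingEnd ℂ) (B g)) - (B g * (starRingEnd ℂ) (A g) -
        B g * (starRingEnd ℂ) (B g)) := by
      intro g
      push_cast
      rw [← Complex.mul_conj', map_sub]; ring
    rw [← intervalIntegral.integral_ofReal]
    simp_rw [this]
    rw [intervalIntegral.integral_sub (j1.sub j2) (j3.sub j4), intervalIntegral.integral_sub j1 j2,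
      intervalIntegral.integral_sub j3 j4, iAA, iAB, iBA, iBB]
    ring
  rw [← Complex.ofReal_sub] at key
  have h0 := Complex.ofReal_injective key
  have h1 : 0 ≤ ∫ g in (-1 / 2 : ℝ)..(1 / 2), ‖A g - B g‖ ^ 2 :=
    integral_freqs_nonneg fun g _ => sq_nonneg _
  linarith

end SpectralFormInequalities

/-! ### Averages against the multitaper spectral window. -/

section WindowAverage

local notation "freqs" => Set.Icc (-1 / 2 : ℝ) (1 / 2)

/-- The Fourier transform, centred at the frequency `h`, of the `k`-th sinusoidal taper. -/
noncomputable abbrev sinWave (N k : ℕ) (h : ℝ) : ℝ → ℂ := taperWave N (sinusoidalTaper N k) h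

lemma continuous_sinWave (N k : ℕ) (h : ℝ) : Continuous (sinWave N k h) :=
  continuous_taperWave _ _ _

/-- The average of `φ` against the multitaper spectral window centred at `h`. -/
noncomputable def windowAvg (N K : ℕ) (h : ℝ) (φ : ℝ → ℝ) : ℝ :=
  1 / (K : ℝ) * ∑ k ∈ Finset.Icc 1 K,
    ∫ g in (-1 / 2 : ℝ)..(1 / 2), φ g * ‖sinWave N k h g‖ ^ 2

lemma continuousOn_mul_norm_sq_sinWave {φ : ℝ → ℝ} (hφ : ContinuousOn φ freqs) (N k : ℕ) (h : ℝ) :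
    ContinuousOn (fun g => φ g * ‖sinWave N k h g‖ ^ 2) freqs :=
  hφ.mul ((continuous_sinWave N k h).norm.pow 2).continuousOn

lemma windowAvg_add {φ ψ : ℝ → ℝ} (hφ : ContinuousOn φ freqs) (hψ : ContinuousOn ψ freqs)
    (N K : ℕ) (h : ℝ) :
    windowAvg N K h (fun g => φ g + ψ g) = windowAvg N K h φ + windowAvg N K h ψ := by
  simp only [windowAvg, add_mul]
  rw [← mul_add, ← Finset.sum_add_distrib]
  congr 1
  refine Finset.sum_congr rfl fun k _ => ?_
  exact intervalIntegral.integral_add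
    (continuousOn_mul_norm_sq_sinWave hφ N k h).intervalIntegrable_freqs
    (continuousOn_mul_norm_sq_sinWave hψ N k h).intervalIntegrable_freqs

lemma windowAvg_const_mul (c : ℝ) (φ : ℝ → ℝ) (N K : ℕ) (h : ℝ) :
    windowAvg N K h (fun g => c * φ g) = c * windowAvg N K h φ := by
  simp only [windowAvg, mul_assoc, intervalIntegral.integral_const_mul, ← Finset.mul_sum]
  ring

lemma windowAvg_mono {φ ψ : ℝ → ℝ} (hφ : ContinuousOn φ freqs) (hψ : ContinuousOn ψ freqs)
    (hle : ∀ g ∈ freqs, φ g ≤ ψ g) (N K : ℕ) (h : ℝ) :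
    windowAvg N K h φ ≤ windowAvg N K h ψ := by
  unfold windowAvg
  gcongr with k _
  refine integral_freqs_mono (continuousOn_mul_norm_sq_sinWave hφ N k h)
    (continuousOn_mul_norm_sq_sinWave hψ N k h) fun g hg => ?_
  gcongr
  exact hle g hg

lemma windowAvg_nonneg {φ : ℝ → ℝ} (h0 : ∀ g ∈ freqs, 0 ≤ φ g) (N K : ℕ) (h : ℝ) :
    0 ≤ windowAvg N K h φ :=
  mul_nonneg (by positivity) (Finset.sum_nonneg fun k _ => integral_freqs_nonneg fun g hg =>
    mul_nonneg (h0 g hg) (sq_nonneg _))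

lemma abs_windowAvg_le {φ : ℝ → ℝ} (hφ : ContinuousOn φ freqs) (N K : ℕ) (h : ℝ) :
    |windowAvg N K h φ| ≤ windowAvg N K h (fun g => |φ g|) := by
  rw [abs_le]
  constructor
  · have := windowAvg_mono (φ := fun g => (-1) * |φ g|) (continuousOn_const.mul hφ.abs) hφ
      (fun g _ => by linarith [neg_abs_le (φ g)]) N K h
    have h2 := windowAvg_const_mul (-1) (fun g => |φ g|) N K h
    linarith
  · exact windowAvg_mono hφ hφ.abs (fun g _ => le_abs_self _) N K h

variable {N K : ℕ}

lemma mem_Icc_of_le {k : ℕ} (hKN : K ≤ N) (hk : k ∈ Finset.Icc 1 K) : k ∈ Finset.Icc 1 N :=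
  Finset.Icc_subset_Icc_right hKN hk

lemma windowAvg_const (hK : 1 ≤ K) (hKN : K ≤ N) (h c : ℝ) :
    windowAvg N K h (fun _ => c) = c := by
  have hK0 : (K : ℝ) ≠ 0 := by positivity
  unfold windowAvg
  rw [Finset.sum_congr rfl fun k hk => by
    rw [intervalIntegral.integral_const_mul,
      integral_norm_sq_taperWave N k (mem_Icc_of_le hKN hk)]]
  simp
  field_simp

lemma windowAvg_sin (h : ℝ) :
    windowAvg N K h (fun g => Real.sin (2 * Real.pi * (g - h))) = 0 := by
  rw [windowAvg, Finset.sum_eq_zero fun k _ => integral_sin_mul_norm_sq_taperWave N _ h, mul_zero]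

lemma windowAvg_sin_sq (hKN : K ≤ N) (h : ℝ) :
    windowAvg N K h (fun g => Real.sin (Real.pi * (g - h)) ^ 2) =
      1 / (K : ℝ) * ∑ k ∈ Finset.Icc 1 K, taperBand N k := by
  unfold windowAvg
  congr 1
  exact Finset.sum_congr rfl fun k hk =>
    integral_sin_sq_mul_norm_sq_taperWave N k (mem_Icc_of_le hKN hk) h

lemma pi_sq_lt_ten : Real.pi ^ 2 < 10 := by
  have := Real.pi_lt_d2
  nlinarith [Real.pi_pos]

lemma sq_pi_mul_div_le (hK : 1 ≤ K) (hKN : K ≤ N) {k : ℕ} (hk : k ≤ K) :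
    (Real.pi * k / (2 * (N + 1))) ^ 2 ≤ 3 * ((K : ℝ) / N) ^ 2 := by
  have hN : (0 : ℝ) < N := by exact_mod_cast (by omega : 0 < N)
  have hk' : (k : ℝ) ≤ K := by exact_mod_cast hk
  have h1 : Real.pi * k / (2 * (N + 1)) ≤ Real.pi * K / (2 * N) := by
    have := Real.pi_pos
    gcongr; linarith
  calc (Real.pi * k / (2 * (N + 1))) ^ 2 ≤ (Real.pi * K / (2 * N)) ^ 2 := by
        gcongr
    _ = Real.pi ^ 2 / 4 * ((K : ℝ) / N) ^ 2 := by field_simp; ring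
    _ ≤ 3 * ((K : ℝ) / N) ^ 2 := by
        gcongr
        linarith [pi_sq_lt_ten]

lemma taperBand_le_three_mul (hK : 1 ≤ K) (hKN : K ≤ N) {k : ℕ} (hk : k ∈ Finset.Icc 1 K) :
    taperBand N k ≤ 3 * ((K : ℝ) / N) ^ 2 :=
  (taperBand_le N k).trans (sq_pi_mul_div_le hK hKN (Finset.mem_Icc.1 hk).2)

lemma avg_le_of_forall_le (hK : 1 ≤ K) {t : ℕ → ℝ} {c : ℝ}
    (h : ∀ k ∈ Finset.Icc 1 K, t k ≤ c) : 1 / (K : ℝ) * ∑ k ∈ Finset.Icc 1 K, t k ≤ c := by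
  have hK0 : (0 : ℝ) < K := by exact_mod_cast hK
  have := Finset.sum_le_sum h
  simp only [Finset.sum_const, Nat.card_Icc, add_tsub_cancel_right, nsmul_eq_mul] at this
  rw [one_div, inv_mul_le_iff₀ hK0]
  exact this

lemma windowAvg_sin_sq_le (hK : 1 ≤ K) (hKN : K ≤ N) (h : ℝ) :
    windowAvg N K h (fun g => Real.sin (Real.pi * (g - h)) ^ 2) ≤ 3 * ((K : ℝ) / N) ^ 2 := by
  rw [windowAvg_sin_sq hKN]
  exact avg_le_of_forall_le hK fun k hk => taperBand_le_three_mul hK hKN hk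

/-- The bound is arranged as `(K/N)²` times a factor that tends to zero when `K/N` does. -/
lemma windowAvg_sin_pow_four_le (hK : 1 ≤ K) (hKN : K ≤ N) (h : ℝ) :
    windowAvg N K h (fun g => Real.sin (Real.pi * (g - h)) ^ 4) ≤
      (9 * ((K : ℝ) / N) ^ 2 + 3 / N) * ((K : ℝ) / N) ^ 2 := by
  have hN : (0 : ℝ) < N := by exact_mod_cast (by omega : 0 < N)
  refine avg_le_of_forall_le hK fun k hk => ?_
  refine (integral_sin_pow_four_mul_norm_sq_taperWave_le N k (mem_Icc_of_le hKN hk) h).trans ?_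
  have h1 := taperBand_le_three_mul hK hKN hk
  have h0 := taperBand_nonneg N k
  calc taperBand N k ^ 2 + taperBand N k / (N + 1)
      ≤ (3 * ((K : ℝ) / N) ^ 2) ^ 2 + (3 * ((K : ℝ) / N) ^ 2) / N := by
        gcongr; linarith
    _ = _ := by ring

lemma abs_sin_sq_sub_sq_le (y : ℝ) : |Real.sin y ^ 2 - y ^ 2| ≤ y ^ 4 := by
  have h1 := Real.abs_sub_sin_le y
  have h2 : |y + Real.sin y| ≤ 2 * |y| :=
    (abs_add_le _ _).trans (by linarith [Real.abs_sin_le_abs (x := y)])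
  have h3 : Real.sin y ^ 2 - y ^ 2 = -((y - Real.sin y) * (y + Real.sin y)) := by ring
  rw [h3, abs_neg, abs_mul]
  calc |y - Real.sin y| * |y + Real.sin y| ≤ (|y| ^ 3 / 6) * (2 * |y|) := by gcongr
    _ = |y| ^ 4 / 3 := by ring
    _ ≤ |y| ^ 4 := by linarith [pow_nonneg (abs_nonneg y) 4]
    _ = y ^ 4 := by rw [← abs_pow, abs_of_nonneg (by positivity)]

lemma sum_Icc_sq (K : ℕ) :
    ∑ k ∈ Finset.Icc 1 K, (k : ℝ) ^ 2 = K * (K + 1) * (2 * K + 1) / 6 := by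
  induction K with
  | zero => simp
  | succ K ih => rw [Finset.sum_Icc_succ_top (by omega), ih]; push_cast; ring

/-- Replacing each sine by its argument costs the first error term. The sum of squares then gives
`π²/24 · (K+1)(2K+1)/(N+1)²`, whose distance from `π²/12 · (K/N)²` is the second. -/
lemma abs_windowAvg_sin_sq_sub_le (hK : 1 ≤ K) (hKN : K ≤ N) (h : ℝ) :
    |windowAvg N K h (fun g => Real.sin (Real.pi * (g - h)) ^ 2) -
      Real.pi ^ 2 / 12 * ((K : ℝ) / N) ^ 2| ≤
      9 * (((K : ℝ) / N) ^ 2) ^ 2 + 4 * (((K : ℝ) / N) ^ 2 / K) := by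
  have hK0 : (0 : ℝ) < K := by exact_mod_cast hK
  have hK1 : (1 : ℝ) ≤ K := by exact_mod_cast hK
  have hKN' : (K : ℝ) ≤ N := by exact_mod_cast hKN
  have hN : (0 : ℝ) < N := by linarith
  rw [windowAvg_sin_sq hKN]
  set a := ((K : ℝ) / N) ^ 2 with ha
  set Y := 1 / (K : ℝ) * ∑ k ∈ Finset.Icc 1 K, (Real.pi * k / (2 * ((N : ℝ) + 1))) ^ 2 with hY
  have h1 : |1 / (K : ℝ) * ∑ k ∈ Finset.Icc 1 K, taperBand N k - Y| ≤ 9 * a ^ 2 := by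
    rw [hY, ← mul_sub, ← Finset.sum_sub_distrib, abs_mul, abs_of_pos (by positivity)]
    refine (mul_le_mul_of_nonneg_left (Finset.abs_sum_le_sum_abs _ _) (by positivity)).trans ?_
    refine avg_le_of_forall_le hK fun k hk => ?_
    refine (abs_sin_sq_sub_sq_le _).trans ?_
    have h2 := sq_pi_mul_div_le hK hKN (Finset.mem_Icc.1 hk).2
    calc (Real.pi * k / (2 * ((N : ℝ) + 1))) ^ 4
        = ((Real.pi * k / (2 * ((N : ℝ) + 1))) ^ 2) ^ 2 := by ring
      _ ≤ (3 * a) ^ 2 := by gcongr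
      _ = _ := by ring
  have e : Y = Real.pi ^ 2 / 24 * ((K + 1) * (2 * K + 1) / ((N : ℝ) + 1) ^ 2) := by
    have : ∀ k : ℕ, (Real.pi * k / (2 * ((N : ℝ) + 1))) ^ 2 =
      Real.pi ^ 2 / (4 * ((N : ℝ) + 1) ^ 2) * (k : ℝ) ^ 2 := by intro k; field_simp; ring
    rw [hY]
    simp_rw [this]
    rw [← Finset.mul_sum, sum_Icc_sq]; field_simp; ring
  have h2 : |(K + 1) * (2 * K + 1) / ((N : ℝ) + 1) ^ 2 - 2 * a| ≤ 8 * (a / K) := by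
    have e1 : a / K = K / (N : ℝ) ^ 2 := by rw [ha]; field_simp
    have e2 : a = (K : ℝ) ^ 2 / (N : ℝ) ^ 2 := by rw [ha]; ring
    rw [e1, e2, abs_le]
    constructor
    -- Passing from `N + 1` to `N` costs a relative error of order `1/N`, which is of order at most
    -- `1/K` because `K ≤ N`.
    · have h3 : (K : ℝ) ^ 2 * (1 / (N : ℝ) ^ 2 - 1 / ((N : ℝ) + 1) ^ 2) ≤ 3 * (K / (N : ℝ) ^ 2) := by
        have : 1 / (N : ℝ) ^ 2 - 1 / ((N : ℝ) + 1) ^ 2 =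
          (2 * N + 1) / ((N : ℝ) ^ 2 * ((N : ℝ) + 1) ^ 2) := by field_simp; ring
        rw [this, mul_div_assoc', mul_div_assoc', div_le_div_iff₀ (by positivity) (by positivity)]
        have h4 : (K : ℝ) * (2 * N + 1) ≤ 3 * ((N : ℝ) + 1) ^ 2 := by nlinarith
        have h5 : 0 ≤ (K : ℝ) * (N : ℝ) ^ 2 := by positivity
        nlinarith
      have h6 : (K + 1) * (2 * K + 1) / ((N : ℝ) + 1) ^ 2 ≥
          2 * ((K : ℝ) ^ 2 * (1 / ((N : ℝ) + 1) ^ 2)) := by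
        rw [ge_iff_le, mul_one_div, mul_div_assoc']
        exact div_le_div_of_nonneg_right (by nlinarith) (by positivity)
      have h7 : 0 ≤ K / (N : ℝ) ^ 2 := by positivity
      have h8 : (K : ℝ) ^ 2 / (N : ℝ) ^ 2 = (K : ℝ) ^ 2 * (1 / (N : ℝ) ^ 2) := by ring
      rw [h8]
      linarith
    · have h3 : (K + 1) * (2 * K + 1) / ((N : ℝ) + 1) ^ 2 ≤
          (2 * (K : ℝ) ^ 2 + 8 * K) / (N : ℝ) ^ 2 := by
        gcongr
        · nlinarith
        · linarith
      rw [add_div] at h3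
      have h4 : 2 * (K : ℝ) ^ 2 / (N : ℝ) ^ 2 = 2 * ((K : ℝ) ^ 2 / (N : ℝ) ^ 2) := by ring
      have h5 : 8 * (K : ℝ) / (N : ℝ) ^ 2 = 8 * (K / (N : ℝ) ^ 2) := by ring
      linarith
  have h3 : |Y - Real.pi ^ 2 / 12 * a| ≤ 4 * (a / K) := by
    have e1 : Y - Real.pi ^ 2 / 12 * a =
      Real.pi ^ 2 / 24 * ((K + 1) * (2 * K + 1) / ((N : ℝ) + 1) ^ 2 - 2 * a) := by rw [e]; ring
    rw [e1, abs_mul, abs_of_pos (by positivity)]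
    have : Real.pi ^ 2 / 24 ≤ 1 / 2 := by linarith [pi_sq_lt_ten]
    calc _ ≤ 1 / 2 * (8 * (a / K)) := by gcongr
      _ = _ := by ring
  exact (abs_sub_le _ Y _).trans (add_le_add h1 h3)

end WindowAverage

/-! ### Mean and variance of the sinusoidal multitaper estimate, with explicit error bounds. -/

section MomentsOfEstimate

local notation "freqs" => Set.Icc (-1 / 2 : ℝ) (1 / 2)

variable {Ω : Type*} [MeasurableSpace Ω] {P : Measure Ω} {x : ℤ → Ω → ℝ} {S : ℝ → ℝ} {N K : ℕ}

lemma integral_sinusoidalMultitaperEstimate (hg : IsGaussianProcess x P)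
    (hx : HasSpectralDensity x P S) (hS : ContinuousOn S freqs) (N K : ℕ) (f : ℝ) :
    ∫ ω, sinusoidalMultitaperEstimate N K (fun n => x n ω) f ∂P = windowAvg N K f S := by
  unfold sinusoidalMultitaperEstimate
  rw [integral_multitaperEstimate hg hx hS, windowAvg, Finset.mul_sum]
  simp only [spectralForm_self, Complex.ofReal_re]

lemma variance_sinusoidalMultitaperEstimate (hg : IsGaussianProcess x P)
    (hx : HasSpectralDensity x P S) (hS : ContinuousOn S freqs) (N K : ℕ) (f : ℝ) :
    Var[fun ω => sinusoidalMultitaperEstimate N K (fun n => x n ω) f; P] =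
      1 / (K : ℝ) ^ 2 * (∑ j ∈ Finset.Icc 1 K, ∑ k ∈ Finset.Icc 1 K,
        ‖spectralForm S (sinWave N j f) (sinWave N k f)‖ ^ 2) +
      1 / (K : ℝ) ^ 2 * (∑ j ∈ Finset.Icc 1 K, ∑ k ∈ Finset.Icc 1 K,
        ‖spectralForm S (sinWave N j f) (sinWave N k (-f))‖ ^ 2) := by
  unfold sinusoidalMultitaperEstimate
  rw [variance_multitaperEstimate hg hx hS, ← mul_add, ← Finset.sum_add_distrib]
  simp only [← Finset.sum_add_distrib, Finset.mul_sum]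
  refine Finset.sum_congr rfl fun j _ => Finset.sum_congr rfl fun k _ => ?_
  ring

/-- This replaces pointwise evenness of `S`, and transfers the smallness of the average at `f` to
the window at `-f` when `S(f) = 0`. -/
lemma windowAvg_neg (hg : IsGaussianProcess x P)
    (hx : HasSpectralDensity x P S) (hS : ContinuousOn S freqs) (N K : ℕ) (f : ℝ) :
    windowAvg N K (-f) S = windowAvg N K f S := by
  have := hg.isProbabilityMeasure
  unfold windowAvg
  congr 1
  refine Finset.sum_congr rfl fun k _ => ?_
  have := spectralForm_taperWave_neg_neg hx hS N (sinusoidalTaper N k) f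
  simpa [spectralForm_self] using this

lemma sum_norm_sq_spectralForm_sinWave_le {φ : ℝ → ℝ} (hφ : ContinuousOn φ freqs) (hKN : K ≤ N)
    {F : ℝ → ℂ} (hF : Continuous F) (h : ℝ) :
    ∑ k ∈ Finset.Icc 1 K, ‖spectralForm φ F (sinWave N k h)‖ ^ 2 ≤
      ∫ g in (-1 / 2 : ℝ)..(1 / 2), φ g ^ 2 * ‖F g‖ ^ 2 := by
  refine sum_norm_sq_spectralForm_le _ (fun k => sinWave N k h)
    (fun k => continuous_sinWave N k h) (fun j hj k hk => ?_) hφ hF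
  rw [integral_taperWave_mul_conj N j k (mem_Icc_of_le hKN hj) (mem_Icc_of_le hKN hk)]
  congr

/-- The energy of a weighted Gram matrix is controlled by the window average of the
squared weight. -/
lemma sum_sum_norm_sq_spectralForm_le {φ : ℝ → ℝ} (hφ : ContinuousOn φ freqs) (hKN : K ≤ N)
    (h h' : ℝ) : 1 / (K : ℝ) ^ 2 * (∑ j ∈ Finset.Icc 1 K, ∑ k ∈ Finset.Icc 1 K,
      ‖spectralForm φ (sinWave N j h) (sinWave N k h')‖ ^ 2) ≤
      1 / (K : ℝ) * windowAvg N K h (fun g => φ g ^ 2) := by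
  rw [windowAvg, ← mul_assoc, one_div_mul_one_div, ← sq]
  gcongr with j _
  exact sum_norm_sq_spectralForm_sinWave_le hφ hKN (continuous_sinWave N j h) h'

/-- Bessel is applied over the first index, so the squared weight is averaged at the second centre.
This suits a weight vanishing at `h'`. -/
lemma sum_sum_norm_sq_spectralForm_le' {φ : ℝ → ℝ} (hφ : ContinuousOn φ freqs) (hKN : K ≤ N)
    (h h' : ℝ) : 1 / (K : ℝ) ^ 2 * (∑ j ∈ Finset.Icc 1 K, ∑ k ∈ Finset.Icc 1 K,
      ‖spectralForm φ (sinWave N j h) (sinWave N k h')‖ ^ 2) ≤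
      1 / (K : ℝ) * windowAvg N K h' (fun g => φ g ^ 2) := by
  rw [Finset.sum_comm]
  refine le_of_eq_of_le ?_ (sum_sum_norm_sq_spectralForm_le hφ hKN h' h)
  congr 1
  refine Finset.sum_congr rfl fun j _ => Finset.sum_congr rfl fun k _ => ?_
  rw [← spectralForm_conj, RCLike.norm_conj]

/-- The energy of a weighted Gram matrix, bounded by the Cauchy-Schwarz inequality. -/
lemma sum_sum_norm_sq_spectralForm_le_mul {φ p q : ℝ → ℝ} (hφ : ContinuousOn φ freqs)
    (hp : ContinuousOn p freqs) (hq : ContinuousOn q freqs) (hp0 : ∀ g ∈ freqs, 0 ≤ p g)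
    (hq0 : ∀ g ∈ freqs, 0 ≤ q g) (hpq : ∀ g ∈ freqs, φ g ^ 2 ≤ p g * q g) (h h' : ℝ) :
    1 / (K : ℝ) ^ 2 * (∑ j ∈ Finset.Icc 1 K, ∑ k ∈ Finset.Icc 1 K,
      ‖spectralForm φ (sinWave N j h) (sinWave N k h')‖ ^ 2) ≤
      windowAvg N K h p * windowAvg N K h' q := by
  have e : windowAvg N K h p * windowAvg N K h' q = 1 / (K : ℝ) ^ 2 *
      ∑ j ∈ Finset.Icc 1 K, ∑ k ∈ Finset.Icc 1 K,
        (∫ g in (-1 / 2 : ℝ)..(1 / 2), p g * ‖sinWave N j h g‖ ^ 2) *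
          ∫ g in (-1 / 2 : ℝ)..(1 / 2), q g * ‖sinWave N k h' g‖ ^ 2 := by
    rw [← Finset.sum_mul_sum, windowAvg, windowAvg]; ring
  rw [e]
  gcongr with j _ k _
  exact norm_sq_spectralForm_le hφ hp hq (continuous_sinWave N j h) (continuous_sinWave N k h')
    hp0 hq0 hpq

lemma norm_add_sq_le (z w : ℂ) : ‖z + w‖ ^ 2 ≤ 2 * ‖z‖ ^ 2 + 2 * ‖w‖ ^ 2 := by
  have h1 := norm_add_le z w
  have h2 : ‖z + w‖ ^ 2 ≤ (‖z‖ + ‖w‖) ^ 2 := by gcongr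
  nlinarith [sq_nonneg (‖z‖ - ‖w‖)]

lemma sum_sum_norm_sq_add_le (z w : ℕ → ℕ → ℂ) (K : ℕ) :
    1 / (K : ℝ) ^ 2 * (∑ j ∈ Finset.Icc 1 K, ∑ k ∈ Finset.Icc 1 K, ‖z j k + w j k‖ ^ 2) ≤
      2 * (1 / (K : ℝ) ^ 2 * ∑ j ∈ Finset.Icc 1 K, ∑ k ∈ Finset.Icc 1 K, ‖z j k‖ ^ 2) +
      2 * (1 / (K : ℝ) ^ 2 * ∑ j ∈ Finset.Icc 1 K, ∑ k ∈ Finset.Icc 1 K, ‖w j k‖ ^ 2) := by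
  have h : ∑ j ∈ Finset.Icc 1 K, ∑ k ∈ Finset.Icc 1 K, ‖z j k + w j k‖ ^ 2 ≤
      2 * (∑ j ∈ Finset.Icc 1 K, ∑ k ∈ Finset.Icc 1 K, ‖z j k‖ ^ 2) +
      2 * ∑ j ∈ Finset.Icc 1 K, ∑ k ∈ Finset.Icc 1 K, ‖w j k‖ ^ 2 := by
    simp only [Finset.mul_sum, ← Finset.sum_add_distrib]
    gcongr with j _ k _
    exact norm_add_sq_le _ _
  calc _ ≤ 1 / (K : ℝ) ^ 2 * (2 * (∑ j ∈ Finset.Icc 1 K, ∑ k ∈ Finset.Icc 1 K, ‖z j k‖ ^ 2) +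
      2 * ∑ j ∈ Finset.Icc 1 K, ∑ k ∈ Finset.Icc 1 K, ‖w j k‖ ^ 2) := by gcongr
    _ = _ := by ring

/-- The mean square of the conjugate-free covariances splits according to
`sin(2πf) = sin(π(g+f)) cos(π(g-f)) - cos(π(g+f)) sin(π(g-f))`. -/
lemma sum_sum_norm_sq_spectralForm_neg_le (hS : ContinuousOn S freqs) {f : ℝ}
    (hf : Real.sin (2 * Real.pi * f) ≠ 0) (N K : ℕ) :
    1 / (K : ℝ) ^ 2 * (∑ j ∈ Finset.Icc 1 K, ∑ k ∈ Finset.Icc 1 K,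
      ‖spectralForm S (sinWave N j f) (sinWave N k (-f))‖ ^ 2) ≤
      2 / Real.sin (2 * Real.pi * f) ^ 2 *
      (1 / (K : ℝ) ^ 2 * (∑ j ∈ Finset.Icc 1 K, ∑ k ∈ Finset.Icc 1 K,
        ‖spectralForm (fun g => S g * Real.sin (Real.pi * (g - -f)) * Real.cos (Real.pi * (g - f)))
          (sinWave N j f) (sinWave N k (-f))‖ ^ 2) +
      1 / (K : ℝ) ^ 2 * (∑ j ∈ Finset.Icc 1 K, ∑ k ∈ Finset.Icc 1 K,
        ‖spectralForm (fun g => S g * Real.sin (Real.pi * (g - f)) * Real.cos (Real.pi * (g - -f)))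
          (sinWave N j f) (sinWave N k (-f))‖ ^ 2)) := by
  set c := Real.sin (2 * Real.pi * f) with hc
  set φ := fun g => S g * Real.sin (Real.pi * (g - -f)) * Real.cos (Real.pi * (g - f)) with hφ
  set ψ := fun g => S g * Real.sin (Real.pi * (g - f)) * Real.cos (Real.pi * (g - -f)) with hψ
  have cφ : ContinuousOn φ freqs := (hS.mul (by fun_prop)).mul (by fun_prop)
  have cψ : ContinuousOn ψ freqs := (hS.mul (by fun_prop)).mul (by fun_prop)
  have hSφ : S = fun g => (1 / c) * φ g + (-1 / c) * ψ g := by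
    ext g
    have : c = Real.sin (Real.pi * (g - -f)) * Real.cos (Real.pi * (g - f)) -
        Real.cos (Real.pi * (g - -f)) * Real.sin (Real.pi * (g - f)) := by
      rw [← Real.sin_sub, hc]; congr 1; ring
    simp only [hφ, hψ]
    field_simp
    rw [this]; ring
  have hB : ∀ j k, spectralForm S (sinWave N j f) (sinWave N k (-f)) =
      spectralForm (fun g => (1 / c) * φ g) (sinWave N j f) (sinWave N k (-f)) +
      spectralForm (fun g => (-1 / c) * ψ g) (sinWave N j f) (sinWave N k (-f)) := by
    intro j k
    rw [← spectralForm_add (φ := fun g => (1 / c) * φ g) (ψ := fun g => (-1 / c) * ψ g)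
      (continuousOn_const.mul cφ) (continuousOn_const.mul cψ)
      (continuous_sinWave _ _ _) (continuous_sinWave _ _ _), ← hSφ]
  simp only [hB]
  refine (sum_sum_norm_sq_add_le _ _ K).trans_eq ?_
  simp only [spectralForm_const_mul, norm_mul, Complex.norm_real, mul_pow, ← Finset.mul_sum,
    Real.norm_eq_abs, sq_abs]
  ring

/-- Variance of the multitaper estimate: `S(f)²/K` up to window averages of functions that
vanish at the centre of the window. -/
lemma abs_variance_sub_le (hg : IsGaussianProcess x P) (hx : HasSpectralDensity x P S)
    (hS : ContinuousOn S freqs) {f : ℝ} (hf : Real.sin (2 * Real.pi * f) ≠ 0) {B : ℝ}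
    (hB : ∀ g ∈ freqs, |S g| ≤ B) (hK : 1 ≤ K) (hKN : K ≤ N) :
    |Var[fun ω => sinusoidalMultitaperEstimate N K (fun n => x n ω) f; P] - S f ^ 2 / K| ≤
      1 / (K : ℝ) * (2 * |S f| * |windowAvg N K f S - S f| +
        windowAvg N K f (fun g => (S g - S f) ^ 2) +
        2 * B ^ 2 / Real.sin (2 * Real.pi * f) ^ 2 *
          (windowAvg N K (-f) (fun g => Real.sin (Real.pi * (g - -f)) ^ 2) +
            windowAvg N K f (fun g => Real.sin (Real.pi * (g - f)) ^ 2))) := by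
  have hK0 : (0 : ℝ) < K := by exact_mod_cast hK
  have cD : ContinuousOn (fun g => S g - S f) freqs := hS.sub continuousOn_const
  set D : ℕ → ℕ → ℂ := fun j k => spectralForm (fun g => S g - S f) (sinWave N j f) (sinWave N k f)
  have hA : ∀ j ∈ Finset.Icc 1 K, ∀ k ∈ Finset.Icc 1 K,
      spectralForm S (sinWave N j f) (sinWave N k f) = (if j = k then (S f : ℂ) else 0) + D j k := by
    intro j hj k hk
    have h1 : spectralForm (fun _ => S f) (sinWave N j f) (sinWave N k f) =
        if j = k then (S f : ℂ) else 0 := by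
      unfold spectralForm
      rw [intervalIntegral.integral_const_mul,
        integral_taperWave_mul_conj N j k (mem_Icc_of_le hKN hj) (mem_Icc_of_le hKN hk)]
      simp
    rw [← h1, ← spectralForm_add continuousOn_const cD (continuous_sinWave _ _ _)
      (continuous_sinWave _ _ _)]
    congr 1; ext g; ring
  have hnorm : ∀ j ∈ Finset.Icc 1 K, ∀ k ∈ Finset.Icc 1 K,
      ‖spectralForm S (sinWave N j f) (sinWave N k f)‖ ^ 2 =
        (if j = k then S f ^ 2 + 2 * S f * (D k k).re else 0) + ‖D j k‖ ^ 2 := by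
    intro j hj k hk
    rw [hA j hj k hk]
    split_ifs with hjk
    · subst hjk
      rw [← Complex.normSq_eq_norm_sq, ← Complex.normSq_eq_norm_sq, Complex.normSq_add]
      simp [Complex.normSq_ofReal]
      ring
    · simp
  -- The Gram matrix is `S(f)` times the identity plus `D`. The cross terms see only the trace of
  -- `D`, which is `K` times the bias.
  have hsum : 1 / (K : ℝ) ^ 2 * (∑ j ∈ Finset.Icc 1 K, ∑ k ∈ Finset.Icc 1 K,
      ‖spectralForm S (sinWave N j f) (sinWave N k f)‖ ^ 2) - S f ^ 2 / K =
      1 / (K : ℝ) * (2 * S f * (windowAvg N K f S - S f)) +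
      1 / (K : ℝ) ^ 2 * (∑ j ∈ Finset.Icc 1 K, ∑ k ∈ Finset.Icc 1 K, ‖D j k‖ ^ 2) := by
    rw [Finset.sum_congr rfl fun j hj => Finset.sum_congr rfl fun k hk => hnorm j hj k hk]
    have h1 : windowAvg N K f S - S f = 1 / (K : ℝ) * ∑ k ∈ Finset.Icc 1 K, (D k k).re := by
      have h2 := windowAvg_add hS (continuousOn_const (c := -S f)) N K f
      rw [windowAvg_const hK hKN] at h2
      rw [sub_eq_add_neg, ← h2, windowAvg]
      simp only [D, spectralForm_self, Complex.ofReal_re, sub_eq_add_neg]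
    have h3 : ∑ j ∈ Finset.Icc 1 K, ∑ k ∈ Finset.Icc 1 K,
        (if j = k then S f ^ 2 + 2 * S f * (D k k).re else 0) =
        K * S f ^ 2 + 2 * S f * ∑ k ∈ Finset.Icc 1 K, (D k k).re := by
      rw [Finset.sum_congr rfl fun j hj => by rw [Finset.sum_ite_eq, if_pos hj],
        Finset.sum_add_distrib, ← Finset.mul_sum]
      simp
    simp only [Finset.sum_add_distrib]
    rw [h1, h3]
    field_simp
    ring
  have hD0 : 0 ≤ 1 / (K : ℝ) ^ 2 * (∑ j ∈ Finset.Icc 1 K, ∑ k ∈ Finset.Icc 1 K, ‖D j k‖ ^ 2) := by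
    positivity
  have hD := sum_sum_norm_sq_spectralForm_le (N := N) (K := K) cD hKN f f
  have hB1 := sum_sum_norm_sq_spectralForm_neg_le hS hf N K
  have hB0 : 0 ≤ 1 / (K : ℝ) ^ 2 * (∑ j ∈ Finset.Icc 1 K, ∑ k ∈ Finset.Icc 1 K,
      ‖spectralForm S (sinWave N j f) (sinWave N k (-f))‖ ^ 2) := by positivity
  have hle : ∀ h h' : ℝ, ∀ g ∈ freqs, (S g * Real.sin (Real.pi * (g - h)) *
      Real.cos (Real.pi * (g - h'))) ^ 2 ≤ B ^ 2 * Real.sin (Real.pi * (g - h)) ^ 2 := by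
    intro h h' g hg
    have h1 : S g ^ 2 ≤ B ^ 2 := by rw [← sq_abs]; gcongr; exact hB g hg
    calc _ = S g ^ 2 * Real.sin (Real.pi * (g - h)) ^ 2 * Real.cos (Real.pi * (g - h')) ^ 2 := by
          ring
      _ ≤ S g ^ 2 * Real.sin (Real.pi * (g - h)) ^ 2 * 1 := by
          gcongr; exact Real.cos_sq_le_one _
      _ ≤ _ := by rw [mul_one]; gcongr
  have hcont : ∀ h h' : ℝ, ContinuousOn (fun g => S g * Real.sin (Real.pi * (g - h)) *
      Real.cos (Real.pi * (g - h'))) freqs :=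
    fun h h' => (hS.mul (by fun_prop)).mul (by fun_prop)
  have hw : ∀ h h' : ℝ, windowAvg N K h (fun g => (S g * Real.sin (Real.pi * (g - h)) *
      Real.cos (Real.pi * (g - h'))) ^ 2) ≤
      B ^ 2 * windowAvg N K h (fun g => Real.sin (Real.pi * (g - h)) ^ 2) := by
    intro h h'
    rw [← windowAvg_const_mul]
    exact windowAvg_mono ((hcont h h').pow 2) (by fun_prop) (hle h h') N K h
  -- Bessel is used so that each weight is averaged at the centre where it vanishes: `-f` here, `f`
  -- in `hB3`.
  have hB2 := (sum_sum_norm_sq_spectralForm_le' (N := N) (K := K) (hcont (-f) f) hKN f (-f)).trans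
    (mul_le_mul_of_nonneg_left (hw (-f) f) (by positivity))
  have hB3 := (sum_sum_norm_sq_spectralForm_le (N := N) (K := K) (hcont f (-f)) hKN f (-f)).trans
    (mul_le_mul_of_nonneg_left (hw f (-f)) (by positivity))
  have hB4 := hB1.trans (mul_le_mul_of_nonneg_left (add_le_add hB2 hB3) (by positivity))
  rw [variance_sinusoidalMultitaperEstimate hg hx hS, add_sub_right_comm, hsum]
  refine (abs_add_le _ _).trans ?_
  rw [abs_of_nonneg hB0]
  refine (add_le_add ((abs_add_le _ _).trans (add_le_add le_rfl
    ((abs_of_nonneg hD0).le.trans hD))) hB4).trans_eq ?_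
  rw [abs_mul, abs_mul, abs_mul, abs_of_pos (by positivity : 0 < 1 / (K : ℝ)), abs_two]
  ring

/-- A variance bound that is sharp when the spectral density vanishes to second order at `f`. -/
lemma variance_le_of_eq_sin_sq_add (hg : IsGaussianProcess x P) (hx : HasSpectralDensity x P S)
    (hS : ContinuousOn S freqs) {f : ℝ} (hf : Real.sin (2 * Real.pi * f) ≠ 0) {c : ℝ} {R : ℝ → ℝ}
    (hR : ContinuousOn R freqs)
    (hSR : ∀ g, S g = c * Real.sin (Real.pi * (g - f)) ^ 2 + R g) (hK : 1 ≤ K) (hKN : K ≤ N) :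
    Var[fun ω => sinusoidalMultitaperEstimate N K (fun n => x n ω) f; P] ≤
      2 * (9 * c ^ 2 * ((((K : ℝ) / N) ^ 2) ^ 2 / K)) + 2 * windowAvg N K f (fun g => |R g|) ^ 2 +
      2 / Real.sin (2 * Real.pi * f) ^ 2 * (windowAvg N K f S *
        (windowAvg N K (-f) (fun g => S g * Real.sin (Real.pi * (g - -f)) ^ 2) +
          windowAvg N K f (fun g => S g * Real.sin (Real.pi * (g - f)) ^ 2))) := by
  have hK0 : (0 : ℝ) < K := by exact_mod_cast hK
  have hS0 := hx.nonneg
  rw [variance_sinusoidalMultitaperEstimate hg hx hS]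
  refine add_le_add ?_ ?_
  -- The `sin²` part of `S` gives a diagonal Gram matrix, so only `K` of the `K²` entries
  -- contribute; this is the source of the factor `1/K` in the first bound.
  · have hA : ∀ j ∈ Finset.Icc 1 K, ∀ k ∈ Finset.Icc 1 K,
        spectralForm S (sinWave N j f) (sinWave N k f) =
          (if j = k then ((c * taperBand N k : ℝ) : ℂ) else 0) +
            spectralForm R (sinWave N j f) (sinWave N k f) := by
      intro j hj k hk
      have h1 : spectralForm (fun g => c * Real.sin (Real.pi * (g - f)) ^ 2) (sinWave N j f)
          (sinWave N k f) = if j = k then ((c * taperBand N k : ℝ) : ℂ) else 0 := by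
        rw [spectralForm_const_mul, spectralForm, integral_sin_sq_mul_taperWave_mul_conj N j k
          (mem_Icc_of_le hKN hj) (mem_Icc_of_le hKN hk)]
        simp
      rw [← h1, ← spectralForm_add (by fun_prop) hR (continuous_sinWave _ _ _)
        (continuous_sinWave _ _ _)]
      congr 1; ext g; exact hSR g
    rw [Finset.sum_congr rfl fun j hj => Finset.sum_congr rfl fun k hk => by rw [hA j hj k hk]]
    refine (sum_sum_norm_sq_add_le _ _ K).trans (add_le_add ?_ ?_)
    · refine mul_le_mul_of_nonneg_left ?_ two_pos.le
      have h1 : ∀ j ∈ Finset.Icc 1 K, ∑ k ∈ Finset.Icc 1 K,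
          ‖if j = k then ((c * taperBand N k : ℝ) : ℂ) else 0‖ ^ 2 ≤
          9 * c ^ 2 * (((K : ℝ) / N) ^ 2) ^ 2 := by
        intro j hj
        have h2 : ∀ k, ‖if j = k then ((c * taperBand N k : ℝ) : ℂ) else 0‖ ^ 2 =
            if j = k then c ^ 2 * taperBand N k ^ 2 else 0 := by
          intro k
          split_ifs
          · rw [Complex.norm_real, Real.norm_eq_abs, sq_abs, mul_pow]
          · simp
        simp_rw [h2]
        rw [Finset.sum_ite_eq, if_pos hj]
        have h3 := taperBand_le_three_mul hK hKN hj
        have h4 := taperBand_nonneg N j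
        calc c ^ 2 * taperBand N j ^ 2 ≤ c ^ 2 * (3 * ((K : ℝ) / N) ^ 2) ^ 2 := by gcongr
          _ = _ := by ring
      have h2 := avg_le_of_forall_le hK h1
      calc _ = 1 / (K : ℝ) * (1 / (K : ℝ) * ∑ j ∈ Finset.Icc 1 K, ∑ k ∈ Finset.Icc 1 K,
          ‖if j = k then ((c * taperBand N k : ℝ) : ℂ) else 0‖ ^ 2) := by ring
        _ ≤ 1 / (K : ℝ) * (9 * c ^ 2 * (((K : ℝ) / N) ^ 2) ^ 2) := by gcongr
        _ = _ := by ring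
    · gcongr
      rw [sq (windowAvg _ _ _ _)]
      exact sum_sum_norm_sq_spectralForm_le_mul hR hR.abs hR.abs (fun _ _ => abs_nonneg _)
        (fun _ _ => abs_nonneg _) (fun g _ => by rw [← sq, sq_abs]) f f
  · refine (sum_sum_norm_sq_spectralForm_neg_le hS hf N K).trans ?_
    gcongr
    rw [mul_add]
    -- Cauchy-Schwarz with weights `S` and `S sin²`, the latter at the centre where the sine
    -- vanishes. When `S(f) = 0` the two averages are `O((K/N)²)` and `o((K/N)²)`.
    have hcs : ∀ h h' : ℝ, ∀ g ∈ freqs, (S g * Real.sin (Real.pi * (g - h)) *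
        Real.cos (Real.pi * (g - h'))) ^ 2 ≤ S g * (S g * Real.sin (Real.pi * (g - h)) ^ 2) := by
      intro h h' g hg
      calc _ = S g ^ 2 * Real.sin (Real.pi * (g - h)) ^ 2 * Real.cos (Real.pi * (g - h')) ^ 2 := by
            ring
        _ ≤ S g ^ 2 * Real.sin (Real.pi * (g - h)) ^ 2 * 1 := by
            gcongr; exact Real.cos_sq_le_one _
        _ = _ := by ring
    have hcont : ∀ h h' : ℝ, ContinuousOn (fun g => S g * Real.sin (Real.pi * (g - h)) *
        Real.cos (Real.pi * (g - h'))) freqs :=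
      fun h h' => (hS.mul (by fun_prop)).mul (by fun_prop)
    have hcont' : ∀ h : ℝ, ContinuousOn (fun g => S g * Real.sin (Real.pi * (g - h)) ^ 2) freqs :=
      fun h => hS.mul (by fun_prop)
    have hnn : ∀ h : ℝ, ∀ g ∈ freqs, 0 ≤ S g * Real.sin (Real.pi * (g - h)) ^ 2 :=
      fun h g hg => mul_nonneg (hS0 g hg) (sq_nonneg _)
    refine add_le_add ?_ ?_
    · exact sum_sum_norm_sq_spectralForm_le_mul (hcont (-f) f) hS (hcont' (-f)) hS0 (hnn (-f))
        (hcs (-f) f) f (-f)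
    · have := sum_sum_norm_sq_spectralForm_le_mul (N := N) (K := K) (hcont f (-f)) (hcont' f) hS
        (hnn f) hS0 (fun g hg => (hcs f (-f) g hg).trans_eq (mul_comm _ _)) f (-f)
      rwa [windowAvg_neg hg hx hS, mul_comm (windowAvg N K f _)] at this

end MomentsOfEstimate

/-! ### Trigonometric Taylor expansion at `f`, with global control of the remainder. -/

section LocalExpansion

local notation "freqs" => Set.Icc (-1 / 2 : ℝ) (1 / 2)

/-- Outside a neighbourhood of `f` where the local bound holds, `φ / χ` is continuous on a compact
set, hence bounded. -/
lemma exists_forall_abs_le_add_mul {φ ψ χ : ℝ → ℝ} {f : ℝ} (hφ : ContinuousOn φ freqs)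
    (hχ : Continuous χ) (hψ0 : ∀ g ∈ freqs, 0 ≤ ψ g) (hχ0 : ∀ g, 0 ≤ χ g)
    (hχ1 : ∀ g ∈ freqs, g ≠ f → χ g ≠ 0) (hloc : ∀ᶠ g in 𝓝 f, |φ g| ≤ ψ g) :
    ∃ C, 0 ≤ C ∧ ∀ g ∈ freqs, |φ g| ≤ ψ g + C * χ g := by
  obtain ⟨U, hU, hUo, hfU⟩ := eventually_nhds_iff.1 hloc
  have hT : IsCompact (freqs \ U) := isCompact_Icc.diff hUo
  have hne : ∀ g ∈ freqs \ U, χ g ≠ 0 := fun g hg =>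
    hχ1 g hg.1 (fun h => hg.2 (h ▸ hfU))
  obtain ⟨C, hC⟩ := hT.exists_bound_of_continuousOn
    ((hφ.mono Set.sdiff_subset).div hχ.continuousOn hne)
  refine ⟨max C 0, le_max_right _ _, fun g hg => ?_⟩
  by_cases hgU : g ∈ U
  · exact (hU g hgU).trans (le_add_of_nonneg_right (mul_nonneg (le_max_right _ _) (hχ0 g)))
  · have h1 := hC g ⟨hg, hgU⟩
    have h2 : 0 < χ g := lt_of_le_of_ne (hχ0 g) (hne g ⟨hg, hgU⟩).symm
    rw [Pi.div_apply, norm_div, Real.norm_eq_abs, Real.norm_eq_abs, abs_of_pos h2,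
      div_le_iff₀ h2] at h1
    have h3 : C * χ g ≤ max C 0 * χ g := by gcongr; exact le_max_left _ _
    linarith [hψ0 g hg]

lemma sin_pi_mul_sub_ne_zero {f g : ℝ} (hf : f ∈ Set.Ioo (-1 / 2 : ℝ) (1 / 2)) (hg : g ∈ freqs)
    (hgf : g ≠ f) : Real.sin (Real.pi * (g - f)) ≠ 0 := by
  have hpi := Real.pi_pos
  intro h
  rw [Real.sin_eq_zero_iff_of_lt_of_lt (by nlinarith [hf.1, hf.2, hg.1, hg.2])
    (by nlinarith [hf.1, hf.2, hg.1, hg.2])] at h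
  rcases mul_eq_zero.1 h with h | h
  · exact hpi.ne' h
  · exact hgf (sub_eq_zero.1 h)

lemma sin_two_pi_mul_ne_zero {f : ℝ} (hf0 : f ≠ 0) (hf : f ∈ Set.Ioo (-1 / 2 : ℝ) (1 / 2)) :
    Real.sin (2 * Real.pi * f) ≠ 0 := by
  have hpi := Real.pi_pos
  intro h
  rw [Real.sin_eq_zero_iff_of_lt_of_lt (by nlinarith [hf.1, hf.2])
    (by nlinarith [hf.1, hf.2])] at h
  rcases mul_eq_zero.1 h with h | h
  · exact (by positivity : 2 * Real.pi ≠ 0) h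
  · exact hf0 h

lemma four_mul_sub_sq_le_sin_sq {f g : ℝ} (h : |g - f| ≤ 1 / 2) :
    4 * (g - f) ^ 2 ≤ Real.sin (Real.pi * (g - f)) ^ 2 := by
  have hpi := Real.pi_pos
  have h1 : |Real.pi * (g - f)| ≤ Real.pi / 2 := by
    rw [abs_mul, abs_of_pos hpi]; nlinarith
  have h2 := Real.mul_abs_le_abs_sin h1
  rw [abs_mul, abs_of_pos hpi] at h2
  have h3 : 2 / Real.pi * (Real.pi * |g - f|) = 2 * |g - f| := by field_simp
  rw [h3] at h2
  rw [← sq_abs (g - f), ← sq_abs (Real.sin _)]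
  nlinarith [abs_nonneg (g - f)]

/-- The remainder of the second order trigonometric expansion of `S` at `f`. -/
noncomputable def trigRemainder (S : ℝ → ℝ) (f g : ℝ) : ℝ :=
  S g - S f - deriv S f / (2 * Real.pi) * Real.sin (2 * Real.pi * (g - f)) -
    iteratedDeriv 2 S f / (2 * Real.pi ^ 2) * Real.sin (Real.pi * (g - f)) ^ 2

lemma taylor_isLittleO_sq {S : ℝ → ℝ} (hS : ContDiffOn ℝ 2 S freqs) {f : ℝ}
    (hf : f ∈ Set.Ioo (-1 / 2 : ℝ) (1 / 2)) :
    (fun g => S g - S f - deriv S f * (g - f) - iteratedDeriv 2 S f / 2 * (g - f) ^ 2)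
      =o[𝓝 f] fun g => (g - f) ^ 2 := by
  have hnhds : freqs ∈ 𝓝 f := Icc_mem_nhds hf.1 hf.2
  have hu : UniqueDiffOn ℝ freqs := uniqueDiffOn_Icc (by norm_num)
  have hfm : f ∈ freqs := Set.Ioo_subset_Icc_self hf
  have hc : ContDiffAt ℝ 2 S f := hS.contDiffAt hnhds
  have h := taylor_isLittleO (convex_Icc _ _) hfm hS
  rw [nhdsWithin_eq_nhds.2 hnhds] at h
  refine h.congr_left fun g => ?_
  rw [taylorWithinEval_succ, taylorWithinEval_succ, taylor_within_zero_eval,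
    iteratedDerivWithin_eq_iteratedDeriv hu (hc.of_le (by norm_num)) hfm,
    iteratedDerivWithin_eq_iteratedDeriv hu (by exact_mod_cast hc) hfm]
  simp [iteratedDeriv_one]
  ring

/-- Replacing `g - f` and `(g - f)²` by the sine functions perturbs Taylor's formula only at orders
three and four. -/
lemma trigRemainder_isLittleO {S : ℝ → ℝ} (hS : ContDiffOn ℝ 2 S freqs) {f : ℝ}
    (hf : f ∈ Set.Ioo (-1 / 2 : ℝ) (1 / 2)) :
    trigRemainder S f =o[𝓝 f] fun g => (g - f) ^ 2 := by
  have hpi := Real.pi_pos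
  have ht : Tendsto (fun g : ℝ => g - f) (𝓝 f) (𝓝 0) := by
    have : ContinuousAt (fun g : ℝ => g - f) f := by fun_prop
    simpa [ContinuousAt] using this
  have hcube : ∀ (c : ℝ) {n : ℕ}, 2 < n → (fun g : ℝ => c * (g - f) ^ n) =o[𝓝 f]
      fun g => (g - f) ^ 2 := fun c n hn =>
    ((isLittleO_pow_pow hn).comp_tendsto ht).const_mul_left c
  have h1 : (fun g => Real.sin (2 * Real.pi * (g - f)) - 2 * Real.pi * (g - f)) =o[𝓝 f]
      fun g => (g - f) ^ 2 := by
    refine IsBigO.trans_isLittleO (IsBigO.of_bound 1 (Eventually.of_forall fun g => ?_))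
      (hcube ((2 * Real.pi) ^ 3) (n := 3) (by norm_num))
    rw [one_mul, ← mul_pow, norm_pow, Real.norm_eq_abs, Real.norm_eq_abs, abs_sub_comm]
    refine (Real.abs_sub_sin_le _).trans ?_
    linarith [pow_nonneg (abs_nonneg (2 * Real.pi * (g - f))) 3]
  have h2 : (fun g => Real.sin (Real.pi * (g - f)) ^ 2 - (Real.pi * (g - f)) ^ 2) =o[𝓝 f]
      fun g => (g - f) ^ 2 := by
    refine IsBigO.trans_isLittleO (IsBigO.of_bound 1 (Eventually.of_forall fun g => ?_))
      (hcube (Real.pi ^ 4) (n := 4) (by norm_num))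
    rw [one_mul, ← mul_pow, Real.norm_eq_abs, Real.norm_eq_abs]
    exact (abs_sin_sq_sub_sq_le _).trans (le_abs_self _)
  have h3 := ((taylor_isLittleO_sq hS hf).sub (h1.const_mul_left (deriv S f / (2 * Real.pi)))).sub
    (h2.const_mul_left (iteratedDeriv 2 S f / (2 * Real.pi ^ 2)))
  refine h3.congr_left fun g => ?_
  simp only [trigRemainder]
  field_simp
  ring

lemma continuousOn_trigRemainder {S : ℝ → ℝ} (hS : ContinuousOn S freqs) (f : ℝ) :
    ContinuousOn (trigRemainder S f) freqs := by
  unfold trigRemainder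
  exact ((hS.sub continuousOn_const).sub (by fun_prop)).sub (by fun_prop)

/-- Peano's remainder near `f`, compactness elsewhere. The far part is charged to `sin⁴` because its
window average is `o((K/N)²)`, so any constant `C` is harmless. -/
lemma abs_trigRemainder_le {S : ℝ → ℝ} (hS : ContDiffOn ℝ 2 S freqs) {f : ℝ}
    (hf : f ∈ Set.Ioo (-1 / 2 : ℝ) (1 / 2)) {ε : ℝ} (hε : 0 < ε) :
    ∃ C, 0 ≤ C ∧ ∀ g ∈ freqs, |trigRemainder S f g| ≤
      ε * Real.sin (Real.pi * (g - f)) ^ 2 + C * Real.sin (Real.pi * (g - f)) ^ 4 := by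
  refine exists_forall_abs_le_add_mul (f := f) (continuousOn_trigRemainder hS.continuousOn f)
    (by fun_prop) (fun g _ => by positivity) (fun g => by positivity)
    (fun g hg hgf => pow_ne_zero _ (sin_pi_mul_sub_ne_zero hf hg hgf)) ?_
  have hb : ∀ᶠ g in 𝓝 f, |g - f| ≤ 1 / 2 := by
    filter_upwards [Metric.ball_mem_nhds f (by norm_num : (0 : ℝ) < 1 / 2)] with g hg
    exact (Metric.mem_ball.1 hg).le
  filter_upwards [(trigRemainder_isLittleO hS hf).bound hε, hb] with g h1 h2
  rw [Real.norm_eq_abs, Real.norm_eq_abs, abs_of_nonneg (sq_nonneg (g - f))] at h1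
  have h3 := four_mul_sub_sq_le_sin_sq h2
  calc _ ≤ ε * (g - f) ^ 2 := h1
    _ ≤ _ := mul_le_mul_of_nonneg_left (by nlinarith [sq_nonneg (g - f)]) hε.le

lemma sq_sub_le {S : ℝ → ℝ} (hS : ContinuousOn S freqs) {f : ℝ}
    (hf : f ∈ Set.Ioo (-1 / 2 : ℝ) (1 / 2)) {ε : ℝ} (hε : 0 < ε) :
    ∃ C, 0 ≤ C ∧ ∀ g ∈ freqs, (S g - S f) ^ 2 ≤
      -- The factor `1` is the comparison function `p` of `windowAvg_isLittleO`.
      ε * 1 + C * Real.sin (Real.pi * (g - f)) ^ 2 := by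
  have hc : ContinuousAt (fun g => |(S g - S f) ^ 2|) f :=
    (((hS.continuousAt (Icc_mem_nhds hf.1 hf.2)).sub continuousAt_const).pow 2).abs
  obtain ⟨C, hC, h⟩ := exists_forall_abs_le_add_mul (f := f) (φ := fun g => (S g - S f) ^ 2)
    (ψ := fun _ => ε * 1) (χ := fun g => Real.sin (Real.pi * (g - f)) ^ 2)
    ((hS.sub continuousOn_const).pow 2)
    (by fun_prop) (fun g _ => by positivity) (fun g => by positivity)
    (fun g hg hgf => pow_ne_zero _ (sin_pi_mul_sub_ne_zero hf hg hgf))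
    (by
      have := hc.eventually (gt_mem_nhds (by simpa using hε))
      exact (this.mono fun g hg => by simpa using hg.le))
  exact ⟨C, hC, fun g hg => (le_abs_self _).trans (h g hg)⟩

end LocalExpansion

/-! ### Asymptotics of window averages and of the bias. -/

section WindowAsymptotics

local notation "freqs" => Set.Icc (-1 / 2 : ℝ) (1 / 2)

variable {K : ℕ → ℕ}

lemma eventually_one_le_and_le (hK : ∀ᶠ N in atTop, 1 ≤ K N)
    (hKN : Tendsto (fun N => (K N : ℝ) / (N : ℝ)) atTop (𝓝 0)) :
    ∀ᶠ N in atTop, 1 ≤ K N ∧ K N ≤ N := by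
  filter_upwards [hK, hKN.eventually (gt_mem_nhds one_pos), eventually_gt_atTop 0] with N h1 h2 h3
  refine ⟨h1, ?_⟩
  rw [div_lt_one (by exact_mod_cast h3)] at h2
  exact_mod_cast h2.le

lemma tendsto_sq_div (hKN : Tendsto (fun N => (K N : ℝ) / (N : ℝ)) atTop (𝓝 0)) :
    Tendsto (fun N => ((K N : ℝ) / (N : ℝ)) ^ 2) atTop (𝓝 0) := by
  simpa using hKN.pow 2

/-- The constant `C` may blow up as `ε → 0`: it is fixed before `N → ∞`, and only multiplies an
average that is already `o(t)`. -/
lemma windowAvg_isLittleO {φ p χ : ℝ → ℝ} {h : ℝ} {t : ℕ → ℝ} (hφ : ContinuousOn φ freqs)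
    (hp : ContinuousOn p freqs) (hχ : ContinuousOn χ freqs) (hφ0 : ∀ g ∈ freqs, 0 ≤ φ g)
    (hb : ∀ ε > 0, ∃ C, 0 ≤ C ∧ ∀ g ∈ freqs, φ g ≤ ε * p g + C * χ g)
    (hpt : (fun N => windowAvg N (K N) h p) =O[atTop] t)
    (hχt : (fun N => windowAvg N (K N) h χ) =o[atTop] t) :
    (fun N => windowAvg N (K N) h φ) =o[atTop] t := by
  obtain ⟨c, hc, hct⟩ := hpt.exists_pos
  refine isLittleO_iff.2 fun ε hε => ?_
  obtain ⟨C, hC, hle⟩ := hb (ε / (2 * c)) (by positivity)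
  filter_upwards [hct.bound, (hχt.const_mul_left C).bound (half_pos hε)] with N h1 h2
  have cp : ContinuousOn (fun g => ε / (2 * c) * p g) freqs := continuousOn_const.mul hp
  have cχ : ContinuousOn (fun g => C * χ g) freqs := continuousOn_const.mul hχ
  have h3 : windowAvg N (K N) h φ ≤ ε / (2 * c) * windowAvg N (K N) h p +
      C * windowAvg N (K N) h χ := by
    rw [← windowAvg_const_mul, ← windowAvg_const_mul,
      ← windowAvg_add cp cχ]
    exact windowAvg_mono hφ (cp.add cχ) hle _ _ _
  rw [Real.norm_of_nonneg (windowAvg_nonneg hφ0 _ _ _)]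
  have h4 : ε / (2 * c) * windowAvg N (K N) h p ≤ ε / (2 * c) * (c * ‖t N‖) := by
    gcongr; exact (Real.le_norm_self _).trans h1
  have h5 : ε / (2 * c) * (c * ‖t N‖) = ε / 2 * ‖t N‖ := by field_simp
  have h6 := (Real.le_norm_self _).trans h2
  linarith

lemma windowAvg_sin_sq_isBigO (hK : ∀ᶠ N in atTop, 1 ≤ K N)
    (hKN : Tendsto (fun N => (K N : ℝ) / (N : ℝ)) atTop (𝓝 0)) (h : ℝ) :
    (fun N => windowAvg N (K N) h (fun g => Real.sin (Real.pi * (g - h)) ^ 2)) =O[atTop]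
      fun N => ((K N : ℝ) / (N : ℝ)) ^ 2 := by
  refine IsBigO.of_bound 3 ?_
  filter_upwards [eventually_one_le_and_le hK hKN] with N hN
  rw [Real.norm_of_nonneg (windowAvg_nonneg (fun _ _ => sq_nonneg _) _ _ _),
    Real.norm_of_nonneg (sq_nonneg _)]
  exact windowAvg_sin_sq_le hN.1 hN.2 h

lemma windowAvg_sin_sq_isLittleO_one (hK : ∀ᶠ N in atTop, 1 ≤ K N)
    (hKN : Tendsto (fun N => (K N : ℝ) / (N : ℝ)) atTop (𝓝 0)) (h : ℝ) :
    (fun N => windowAvg N (K N) h (fun g => Real.sin (Real.pi * (g - h)) ^ 2)) =o[atTop]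
      fun _ => (1 : ℝ) :=
  (windowAvg_sin_sq_isBigO hK hKN h).trans_isLittleO
    ((isLittleO_one_iff ℝ).2 (tendsto_sq_div hKN))

lemma windowAvg_sin_pow_four_isLittleO (hK : ∀ᶠ N in atTop, 1 ≤ K N)
    (hKN : Tendsto (fun N => (K N : ℝ) / (N : ℝ)) atTop (𝓝 0)) (h : ℝ) :
    (fun N => windowAvg N (K N) h (fun g => Real.sin (Real.pi * (g - h)) ^ 4)) =o[atTop]
      fun N => ((K N : ℝ) / (N : ℝ)) ^ 2 := by
  have h1 : Tendsto (fun N : ℕ => 9 * ((K N : ℝ) / N) ^ 2 + 3 / (N : ℝ)) atTop (𝓝 0) := by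
    simpa using ((tendsto_sq_div hKN).const_mul 9).add (tendsto_const_div_atTop_nhds_zero_nat 3)
  have h2 := ((isLittleO_one_iff ℝ).2 h1).mul_isBigO
    (isBigO_refl (fun N => ((K N : ℝ) / (N : ℝ)) ^ 2) atTop)
  simp only [one_mul] at h2
  refine IsBigO.trans_isLittleO (IsBigO.of_bound 1 ?_) h2
  filter_upwards [eventually_one_le_and_le hK hKN] with N hN
  rw [Real.norm_of_nonneg (windowAvg_nonneg (fun _ _ => by positivity) _ _ _), one_mul,
    Real.norm_of_nonneg (by positivity)]
  exact windowAvg_sin_pow_four_le hN.1 hN.2 h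

variable {S : ℝ → ℝ} {f : ℝ}

lemma windowAvg_abs_trigRemainder_isLittleO (hS : ContDiffOn ℝ 2 S freqs)
    (hf : f ∈ Set.Ioo (-1 / 2 : ℝ) (1 / 2)) (hK : ∀ᶠ N in atTop, 1 ≤ K N)
    (hKN : Tendsto (fun N => (K N : ℝ) / (N : ℝ)) atTop (𝓝 0)) :
    (fun N => windowAvg N (K N) f (fun g => |trigRemainder S f g|)) =o[atTop]
      fun N => ((K N : ℝ) / (N : ℝ)) ^ 2 :=
  windowAvg_isLittleO (continuousOn_trigRemainder hS.continuousOn f).abs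
    (by fun_prop : ContinuousOn (fun g => Real.sin (Real.pi * (g - f)) ^ 2) freqs)
    (by fun_prop : ContinuousOn (fun g => Real.sin (Real.pi * (g - f)) ^ 4) freqs)
    (fun _ _ => abs_nonneg _) (fun _ hε => abs_trigRemainder_le hS hf hε)
    (windowAvg_sin_sq_isBigO hK hKN f) (windowAvg_sin_pow_four_isLittleO hK hKN f)

/-- The bias is `S''(f) (K/N)² / 24` up to `o((K/N)²) + O((K/N)²/K)`. -/
lemma windowAvg_sub_sub_isLittleO (hS : ContDiffOn ℝ 2 S freqs)
    (hf : f ∈ Set.Ioo (-1 / 2 : ℝ) (1 / 2)) (hK : ∀ᶠ N in atTop, 1 ≤ K N)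
    (hKN : Tendsto (fun N => (K N : ℝ) / (N : ℝ)) atTop (𝓝 0)) {t : ℕ → ℝ}
    (hat : (fun N => ((K N : ℝ) / (N : ℝ)) ^ 2) =O[atTop] t)
    (hat' : (fun N => ((K N : ℝ) / (N : ℝ)) ^ 2 / (K N : ℝ)) =o[atTop] t) :
    (fun N => windowAvg N (K N) f S - S f -
      iteratedDeriv 2 S f / 24 * ((K N : ℝ) / (N : ℝ)) ^ 2) =o[atTop] t := by
  set c := iteratedDeriv 2 S f / (2 * Real.pi ^ 2) with hc
  have cR := continuousOn_trigRemainder hS.continuousOn f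
  have hR : (fun N => windowAvg N (K N) f (trigRemainder S f)) =o[atTop] t := by
    refine (IsBigO.of_bound 1 (Eventually.of_forall fun N => ?_)).trans_isLittleO
      ((windowAvg_abs_trigRemainder_isLittleO hS hf hK hKN).trans_isBigO hat)
    rw [one_mul, Real.norm_eq_abs]
    exact (abs_windowAvg_le cR _ _ _).trans (le_abs_self _)
  have hsq : (fun N => 9 * (((K N : ℝ) / (N : ℝ)) ^ 2) ^ 2) =o[atTop] t := by
    have := ((isLittleO_one_iff ℝ).2 (tendsto_sq_div hKN)).mul_isBigO hat
    simp only [one_mul, ← sq] at this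
    exact this.const_mul_left 9
  have hW : (fun N => windowAvg N (K N) f (fun g => Real.sin (Real.pi * (g - f)) ^ 2) -
      Real.pi ^ 2 / 12 * ((K N : ℝ) / N) ^ 2) =o[atTop] t := by
    refine (IsBigO.of_bound 1 ?_).trans_isLittleO (hsq.add (hat'.const_mul_left 4))
    filter_upwards [eventually_one_le_and_le hK hKN] with N hN
    rw [one_mul, Real.norm_eq_abs]
    exact (abs_windowAvg_sin_sq_sub_le hN.1 hN.2 f).trans (le_abs_self _)
  refine ((hW.const_mul_left c).add hR).congr' ?_ EventuallyEq.rfl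
  filter_upwards [eventually_one_le_and_le hK hKN] with N hN
  -- The first-order term has zero average because the window is even, and `c · π²/12 = S''(f)/24`.
  have hdec : S = fun g => (S f + deriv S f / (2 * Real.pi) * Real.sin (2 * Real.pi * (g - f))) +
      (c * Real.sin (Real.pi * (g - f)) ^ 2 + trigRemainder S f g) := by
    ext g; simp only [trigRemainder, hc]; ring
  have h1 : windowAvg N (K N) f S = S f + c * windowAvg N (K N) f
      (fun g => Real.sin (Real.pi * (g - f)) ^ 2) + windowAvg N (K N) f (trigRemainder S f) := by
    have c1 : ContinuousOn (fun _ : ℝ => S f) freqs := continuousOn_const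
    have c2 : ContinuousOn (fun g => deriv S f / (2 * Real.pi) *
      Real.sin (2 * Real.pi * (g - f))) freqs := by fun_prop
    have c3 : ContinuousOn (fun g => c * Real.sin (Real.pi * (g - f)) ^ 2) freqs := by fun_prop
    have c12 : ContinuousOn (fun g => S f + deriv S f / (2 * Real.pi) *
      Real.sin (2 * Real.pi * (g - f))) freqs := c1.add c2
    have c34 : ContinuousOn (fun g => c * Real.sin (Real.pi * (g - f)) ^ 2 +
      trigRemainder S f g) freqs := c3.add cR
    conv_lhs => rw [hdec]
    rw [windowAvg_add c12 c34, windowAvg_add c1 c2, windowAvg_add c3 cR,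
      windowAvg_const hN.1 hN.2, windowAvg_const_mul, windowAvg_const_mul, windowAvg_sin]
    ring
  rw [h1, hc]
  field_simp
  ring

end WindowAsymptotics

/-! ### Asymptotics of the variance and of the local loss. -/

section LossAsymptotics

local notation "freqs" => Set.Icc (-1 / 2 : ℝ) (1 / 2)

variable {Ω : Type*} [MeasurableSpace Ω] {P : Measure Ω} {x : ℤ → Ω → ℝ} {S : ℝ → ℝ}
  {K : ℕ → ℕ} {f : ℝ}

lemma sq_sub_sq_isLittleO {b β t : ℕ → ℝ} (h : (fun N => b N - β N) =o[atTop] t)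
    (hβ : β =O[atTop] t) : (fun N => b N ^ 2 - β N ^ 2) =o[atTop] fun N => t N ^ 2 := by
  have h1 : (fun N => b N + β N) =O[atTop] t := by
    refine (h.isBigO.add (hβ.const_mul_left 2)).congr_left fun N => ?_
    ring
  exact (h.mul_isBigO h1).congr (fun N => by ring) fun N => by ring

lemma sq_div_isLittleO_one (hK : ∀ᶠ N in atTop, 1 ≤ K N)
    (hKN : Tendsto (fun N => (K N : ℝ) / (N : ℝ)) atTop (𝓝 0)) :
    (fun N => ((K N : ℝ) / (N : ℝ)) ^ 2 / (K N : ℝ)) =o[atTop] fun _ => (1 : ℝ) := by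
  refine (IsBigO.of_bound 1 ?_).trans_isLittleO ((isLittleO_one_iff ℝ).2 (tendsto_sq_div hKN))
  filter_upwards [hK] with N hN
  rw [Real.norm_of_nonneg (by positivity), Real.norm_of_nonneg (by positivity), one_mul]
  exact div_le_self (by positivity) (by exact_mod_cast hN)

lemma windowAvg_sub_isLittleO_one (hS : ContDiffOn ℝ 2 S freqs)
    (hf : f ∈ Set.Ioo (-1 / 2 : ℝ) (1 / 2)) (hK : ∀ᶠ N in atTop, 1 ≤ K N)
    (hKN : Tendsto (fun N => (K N : ℝ) / (N : ℝ)) atTop (𝓝 0)) :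
    (fun N => windowAvg N (K N) f S - S f) =o[atTop] fun _ => (1 : ℝ) := by
  have ha := (isLittleO_one_iff ℝ).2 (tendsto_sq_div hKN)
  refine ((windowAvg_sub_sub_isLittleO hS hf hK hKN ha.isBigO
    (sq_div_isLittleO_one hK hKN)).add
    (ha.const_mul_left (iteratedDeriv 2 S f / 24))).congr_left fun N => ?_
  ring

/-- The variance of the multitaper estimate is `S(f)²/K + o(1/K)`. -/
lemma variance_sub_isLittleO (hg : IsGaussianProcess x P) (hx : HasSpectralDensity x P S)
    (hS : ContDiffOn ℝ 2 S freqs) (hf0 : f ≠ 0) (hf : f ∈ Set.Ioo (-1 / 2 : ℝ) (1 / 2))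
    (hK : ∀ᶠ N in atTop, 1 ≤ K N)
    (hKN : Tendsto (fun N => (K N : ℝ) / (N : ℝ)) atTop (𝓝 0)) :
    (fun N => Var[fun ω => sinusoidalMultitaperEstimate N (K N) (fun n => x n ω) f; P] -
      S f ^ 2 / (K N : ℝ)) =o[atTop] fun N => 1 / (K N : ℝ) := by
  have hc := hS.continuousOn
  obtain ⟨B, hB⟩ := isCompact_Icc.exists_bound_of_continuousOn hc
  have h1 : (fun N => windowAvg N (K N) f (fun g => (S g - S f) ^ 2)) =o[atTop]
      fun _ => (1 : ℝ) := by
    refine windowAvg_isLittleO (p := fun _ => 1)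
      (χ := fun g => Real.sin (Real.pi * (g - f)) ^ 2)
      ((hc.sub continuousOn_const).pow 2) continuousOn_const (by fun_prop)
      (fun _ _ => sq_nonneg _) (fun ε hε => sq_sub_le hc hf hε) ?_
      (windowAvg_sin_sq_isLittleO_one hK hKN f)
    refine (isBigO_refl (fun _ : ℕ => (1 : ℝ)) atTop).congr' ?_ EventuallyEq.rfl
    filter_upwards [eventually_one_le_and_le hK hKN] with N hN
    rw [windowAvg_const hN.1 hN.2]
  have hX := (((windowAvg_sub_isLittleO_one hS hf hK hKN).norm_left.const_mul_left
    (2 * |S f|)).add h1).add (((windowAvg_sin_sq_isLittleO_one hK hKN (-f)).add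
      (windowAvg_sin_sq_isLittleO_one hK hKN f)).const_mul_left
        (2 * B ^ 2 / Real.sin (2 * Real.pi * f) ^ 2))
  have hX' := (isBigO_refl (fun N => 1 / (K N : ℝ)) atTop).mul_isLittleO hX
  simp only [mul_one] at hX'
  refine (IsBigO.of_bound 1 ?_).trans_isLittleO hX'
  filter_upwards [eventually_one_le_and_le hK hKN] with N hN
  rw [one_mul, Real.norm_eq_abs]
  exact (abs_variance_sub_le hg hx hc (sin_two_pi_mul_ne_zero hf0 hf) hB hN.1 hN.2).trans
    (le_abs_self _)

lemma estimatorBias_sinusoidalMultitaperEstimate (hg : IsGaussianProcess x P)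
    (hx : HasSpectralDensity x P S) (hS : ContinuousOn S freqs) (N K : ℕ) (f : ℝ) :
    estimatorBias P (fun ω => sinusoidalMultitaperEstimate N K (fun n => x n ω) f) (S f) =
      windowAvg N K f S - S f := by
  rw [estimatorBias, integral_sinusoidalMultitaperEstimate hg hx hS]

lemma asymptoticLoss_eq (S : ℝ → ℝ) (f : ℝ) (N K : ℕ) : asymptoticLoss S f N K =
    (iteratedDeriv 2 S f / 24 * ((K : ℝ) / N) ^ 2) ^ 2 + S f ^ 2 / K := by
  rw [asymptoticLoss]; congr 2; ring

theorem localLoss_sub_asymptoticLoss_isLittleO (hg : IsGaussianProcess x P)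
    (hx : HasSpectralDensity x P S) (hS : ContDiffOn ℝ 2 S freqs) (hf0 : f ≠ 0)
    (hf : f ∈ Set.Ioo (-1 / 2 : ℝ) (1 / 2)) (hK : ∀ᶠ N in atTop, 1 ≤ K N)
    (hKN : Tendsto (fun N => (K N : ℝ) / (N : ℝ)) atTop (𝓝 0)) :
    (fun N => localLoss P (fun ω => sinusoidalMultitaperEstimate N (K N) (fun n => x n ω) f) (S f)
        - asymptoticLoss S f N (K N))
      =o[atTop] fun N => ((K N : ℝ) / (N : ℝ)) ^ 4 + 1 / (K N : ℝ) := by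
  -- Scale for the unsquared bias: `t²` is at most twice the target rate. The summand `1/√K` absorbs
  -- the error `(K/N)²/K` even when `K` stays bounded.
  set t : ℕ → ℝ := fun N => ((K N : ℝ) / (N : ℝ)) ^ 2 + 1 / Real.sqrt (K N : ℝ) with ht
  have hat : (fun N => ((K N : ℝ) / (N : ℝ)) ^ 2) =O[atTop] t := by
    refine IsBigO.of_bound 1 (Eventually.of_forall fun N => ?_)
    rw [one_mul, Real.norm_of_nonneg (by positivity), Real.norm_of_nonneg (by positivity)]
    exact le_add_of_nonneg_right (by positivity)
  have hat' : (fun N => ((K N : ℝ) / (N : ℝ)) ^ 2 / (K N : ℝ)) =o[atTop] t := by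
    have h1 : (fun N => ((K N : ℝ) / (N : ℝ)) ^ 2 * (1 / Real.sqrt (K N : ℝ))) =o[atTop]
        fun N => 1 * (1 / Real.sqrt (K N : ℝ)) :=
      ((isLittleO_one_iff ℝ).2 (tendsto_sq_div hKN)).mul_isBigO (isBigO_refl _ _)
    refine (IsBigO.of_bound 1 ?_).trans_isLittleO (h1.trans_isBigO (IsBigO.of_bound 1
      (Eventually.of_forall fun N => ?_)))
    · filter_upwards [hK] with N hN
      have h2 : (1 : ℝ) ≤ K N := by exact_mod_cast hN
      rw [one_mul, Real.norm_of_nonneg (by positivity), Real.norm_of_nonneg (by positivity),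
        mul_one_div]
      have h3 : Real.sqrt (K N : ℝ) ≤ K N := Real.sqrt_le_self_iff.2 (Or.inr h2)
      have h4 : 0 < Real.sqrt (K N : ℝ) := Real.sqrt_pos.2 (by linarith)
      gcongr
    · rw [one_mul, one_mul, Real.norm_of_nonneg (by positivity), Real.norm_of_nonneg (by positivity)]
      exact le_add_of_nonneg_left (by positivity)
  have hb := sq_sub_sq_isLittleO (windowAvg_sub_sub_isLittleO hS hf hK hKN hat hat')
    (hat.const_mul_left (iteratedDeriv 2 S f / 24))
  have ht2 : (fun N => t N ^ 2) =O[atTop]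
      fun N => ((K N : ℝ) / (N : ℝ)) ^ 4 + 1 / (K N : ℝ) := by
    refine IsBigO.of_bound 2 (Eventually.of_forall fun N => ?_)
    rw [Real.norm_of_nonneg (by positivity), Real.norm_of_nonneg (by positivity)]
    have h1 : (1 / Real.sqrt (K N : ℝ)) ^ 2 = 1 / (K N : ℝ) := by
      rw [div_pow, Real.sq_sqrt (by positivity), one_pow]
    have h2 : ((K N : ℝ) / (N : ℝ)) ^ 4 = (((K N : ℝ) / (N : ℝ)) ^ 2) ^ 2 := by ring
    rw [h2, ← h1]
    simp only [ht]
    nlinarith [sq_nonneg (((K N : ℝ) / (N : ℝ)) ^ 2 - 1 / Real.sqrt (K N : ℝ))]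
  have hv := (variance_sub_isLittleO hg hx hS hf0 hf hK hKN).trans_isBigO
    (k := fun N => ((K N : ℝ) / (N : ℝ)) ^ 4 + 1 / (K N : ℝ))
    (IsBigO.of_bound 1 (Eventually.of_forall fun N => by
      rw [one_mul, Real.norm_of_nonneg (by positivity), Real.norm_of_nonneg (by positivity)]
      exact le_add_of_nonneg_left (by positivity)))
  refine ((hb.trans_isBigO ht2).add hv).congr_left fun N => ?_
  rw [localLoss, estimatorBias_sinusoidalMultitaperEstimate hg hx hS.continuousOn,
    asymptoticLoss_eq]
  ring

/-- If the spectral density vanishes at `f` and the number of tapers grows, the loss is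
`[S''(f)K²/(24N²)]² + o(K⁴/N⁴)`. -/
theorem localLoss_sub_isLittleO_of_eq_zero (hg : IsGaussianProcess x P)
    (hx : HasSpectralDensity x P S) (hS : ContDiffOn ℝ 2 S freqs) (hf0 : f ≠ 0)
    (hf : f ∈ Set.Ioo (-1 / 2 : ℝ) (1 / 2))
    (hKN : Tendsto (fun N => (K N : ℝ) / (N : ℝ)) atTop (𝓝 0)) (hSf : S f = 0)
    (hK : Tendsto K atTop atTop) :
    (fun N => localLoss P (fun ω => sinusoidalMultitaperEstimate N (K N) (fun n => x n ω) f) (S f)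
        - asymptoticLoss S f N (K N))
      =o[atTop] fun N => (((K N : ℝ) / (N : ℝ)) ^ 2) ^ 2 := by
  have hK1 : ∀ᶠ N in atTop, 1 ≤ K N := hK.eventually_ge_atTop 1
  have hc := hS.continuousOn
  have hS0 := hx.nonneg
  set a : ℕ → ℝ := fun N => ((K N : ℝ) / (N : ℝ)) ^ 2 with ha
  have hKinv : (fun N => 1 / (K N : ℝ)) =o[atTop] fun _ => (1 : ℝ) := by
    rw [isLittleO_one_iff]
    exact tendsto_one_div_atTop_nhds_zero_nat.comp hK
  -- Without `1/K` in the target rate, this error is negligible only because `K → ∞`.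
  have hat' : (fun N => ((K N : ℝ) / (N : ℝ)) ^ 2 / (K N : ℝ)) =o[atTop] a := by
    have := (isBigO_refl a atTop).mul_isLittleO hKinv
    simpa only [mul_one_div, mul_one] using this
  have hbias := windowAvg_sub_sub_isLittleO hS hf hK1 hKN (isBigO_refl a atTop) hat'
  have hb := sq_sub_sq_isLittleO hbias
    ((isBigO_refl a atTop).const_mul_left (iteratedDeriv 2 S f / 24))
  have hm : (fun N => windowAvg N (K N) f S) =O[atTop] a := by
    refine (hbias.isBigO.add ((isBigO_refl a atTop).const_mul_left
      (iteratedDeriv 2 S f / 24))).congr_left fun N => ?_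
    simp only [ha, hSf]; ring
  have hm' : (fun N => windowAvg N (K N) (-f) S) =O[atTop] a :=
    hm.congr_left fun N => (windowAvg_neg hg hx hc N (K N) f).symm
  -- `S ≥ 0` and `S f = 0` make `f` a local minimum.
  have hderiv : deriv S f = 0 := by
    refine IsLocalMin.deriv_eq_zero ?_
    filter_upwards [Icc_mem_nhds hf.1 hf.2] with g hgm
    rw [hSf]; exact hS0 g hgm
  set c := iteratedDeriv 2 S f / (2 * Real.pi ^ 2) with hcdef
  have hSR : ∀ g, S g = c * Real.sin (Real.pi * (g - f)) ^ 2 + trigRemainder S f g := by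
    intro g; simp only [trigRemainder, hSf, hderiv, hcdef]; ring
  obtain ⟨B, hB⟩ := isCompact_Icc.exists_bound_of_continuousOn hc
  have hB0 : 0 ≤ B := (norm_nonneg _).trans (hB f (Set.Ioo_subset_Icc_self hf))
  -- Only the size of the average of `S` at `h` is used, so the claim applies at `-f` without local
  -- information there. The constant `B / (4ε)` comes from `y ≤ ε + y²/(4ε)` with `y = sin²`.
  have hweight : ∀ h, (fun N => windowAvg N (K N) h S) =O[atTop] a →
      (fun N => windowAvg N (K N) h (fun g => S g * Real.sin (Real.pi * (g - h)) ^ 2))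
        =o[atTop] a := by
    intro h hh
    refine windowAvg_isLittleO (p := S) (χ := fun g => Real.sin (Real.pi * (g - h)) ^ 4)
      (hc.mul (by fun_prop)) hc (by fun_prop) (fun g hgm => mul_nonneg (hS0 g hgm) (sq_nonneg _))
      (fun ε hε => ⟨B / (4 * ε), by positivity, fun g hgm => ?_⟩) hh
      (windowAvg_sin_pow_four_isLittleO hK1 hKN h)
    have h1 : S g ≤ B := (le_abs_self _).trans (hB g hgm)
    have h2 := hS0 g hgm
    set y := Real.sin (Real.pi * (g - h)) ^ 2 with hy
    have h3 : Real.sin (Real.pi * (g - h)) ^ 4 = y ^ 2 := by rw [hy]; ring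
    rw [h3]
    have h4 : y ≤ ε + y ^ 2 / (4 * ε) := by
      have : ε + y ^ 2 / (4 * ε) - y = (y - 2 * ε) ^ 2 / (4 * ε) := by field_simp; ring
      have h5 : 0 ≤ (y - 2 * ε) ^ 2 / (4 * ε) := by positivity
      linarith
    calc S g * y ≤ S g * (ε + y ^ 2 / (4 * ε)) := by gcongr
      _ = ε * S g + S g * (y ^ 2 / (4 * ε)) := by ring
      _ ≤ ε * S g + B * (y ^ 2 / (4 * ε)) := by gcongr
      _ = _ := by ring
  have hR := windowAvg_abs_trigRemainder_isLittleO hS hf hK1 hKN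
  have hv1 : (fun N => 2 * (9 * c ^ 2 * (a N ^ 2 / (K N : ℝ)))) =o[atTop] fun N => a N ^ 2 := by
    have := (isBigO_refl (fun N => a N ^ 2) atTop).mul_isLittleO hKinv
    simp only [mul_one_div, mul_one] at this
    exact (this.const_mul_left (9 * c ^ 2)).const_mul_left 2
  have hv2 := (hR.pow two_pos).const_mul_left 2
  have hv3 : (fun N => 2 / Real.sin (2 * Real.pi * f) ^ 2 * (windowAvg N (K N) f S *
      (windowAvg N (K N) (-f) (fun g => S g * Real.sin (Real.pi * (g - -f)) ^ 2) +
        windowAvg N (K N) f (fun g => S g * Real.sin (Real.pi * (g - f)) ^ 2)))) =o[atTop]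
      fun N => a N ^ 2 := by
    have := hm.mul_isLittleO ((hweight (-f) hm').add (hweight f hm))
    simp only [← sq] at this
    exact this.const_mul_left _
  have hv : (fun N => Var[fun ω => sinusoidalMultitaperEstimate N (K N) (fun n => x n ω) f; P])
      =o[atTop] fun N => a N ^ 2 := by
    refine (IsBigO.of_bound 1 ?_).trans_isLittleO ((hv1.add hv2).add hv3)
    filter_upwards [eventually_one_le_and_le hK1 hKN] with N hN
    rw [one_mul, Real.norm_of_nonneg (variance_nonneg _ _)]
    exact (variance_le_of_eq_sin_sq_add hg hx hc (sin_two_pi_mul_ne_zero hf0 hf)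
      (continuousOn_trigRemainder hc f) hSR hN.1 hN.2).trans (Real.le_norm_self _)
  refine (hb.add hv).congr_left fun N => ?_
  rw [localLoss, estimatorBias_sinusoidalMultitaperEstimate hg hx hc, asymptoticLoss_eq, hSf]
  ring

end LossAsymptotics

theorem mainTheorem10 {Ω : Type*} [MeasurableSpace Ω] (P : Measure Ω) [IsProbabilityMeasure P]
    (x : ℤ → Ω → ℝ) (S : ℝ → ℝ)
    (hgauss : IsGaussianProcess x P)
    (hspec : HasSpectralDensity x P S)
    (hS : ContDiffOn ℝ 2 S (Set.Icc (-1 / 2) (1 / 2)))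
    (f : ℝ) (hf0 : f ≠ 0) (hf : f ∈ Set.Ioo (-1 / 2 : ℝ) (1 / 2))
    (K : ℕ → ℕ) (hK : ∀ᶠ N in atTop, 1 ≤ K N)
    (hKN : Tendsto (fun N => (K N : ℝ) / (N : ℝ)) atTop (𝓝 0)) :
    ((fun N => localLoss P (fun ω => sinusoidalMultitaperEstimate N (K N) (fun n => x n ω) f) (S f)
        - asymptoticLoss S f N (K N))
      =o[atTop] fun N => ((K N : ℝ) / (N : ℝ)) ^ 4 + 1 / (K N : ℝ)) ∧
    (iteratedDeriv 2 S f ≠ 0 → (S f ≠ 0 ∨ Tendsto K atTop atTop) →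
      (fun N => localLoss P (fun ω => sinusoidalMultitaperEstimate N (K N) (fun n => x n ω) f) (S f))
        ~[atTop] fun N => asymptoticLoss S f N (K N)) := by
  have h1 := localLoss_sub_asymptoticLoss_isLittleO hgauss hspec hS hf0 hf hK hKN
  refine ⟨h1, fun hS2 hor => ?_⟩
  have hd : 0 < (iteratedDeriv 2 S f / 24) ^ 2 := by positivity
  -- If `S f = 0`, the asymptotic loss has no `1/K` term to absorb the general remainder, so the
  -- finer estimate is required.
  by_cases hSf : S f = 0
  · have hKt := hor.resolve_left (not_not.2 hSf)
    refine (localLoss_sub_isLittleO_of_eq_zero hgauss hspec hS hf0 hf hKN hSf hKt).trans_isBigO ?_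
    refine IsBigO.of_bound ((iteratedDeriv 2 S f / 24) ^ 2)⁻¹ (Eventually.of_forall fun N => ?_)
    rw [asymptoticLoss_eq, hSf, Real.norm_of_nonneg (by positivity),
      Real.norm_of_nonneg (by positivity), mul_pow, mul_add, inv_mul_cancel_left₀ hd.ne']
    simp
  · have hs : 0 < S f ^ 2 := by positivity
    refine h1.trans_isBigO ?_
    -- Both coefficients of the asymptotic loss are positive. Multiplying it by the sum of their
    -- inverses recovers `(K/N)⁴ + 1/K` plus nonnegative cross terms.
    refine IsBigO.of_bound (((iteratedDeriv 2 S f / 24) ^ 2)⁻¹ + (S f ^ 2)⁻¹)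
      (Eventually.of_forall fun N => ?_)
    rw [asymptoticLoss_eq, Real.norm_of_nonneg (by positivity),
      Real.norm_of_nonneg (by positivity), mul_pow]
    set d := (iteratedDeriv 2 S f / 24) ^ 2
    set A := ((K N : ℝ) / (N : ℝ)) ^ 2 with hA
    have e : ((K N : ℝ) / (N : ℝ)) ^ 4 = A ^ 2 := by rw [hA]; ring
    have e2 : (d⁻¹ + (S f ^ 2)⁻¹) * (d * A ^ 2 + S f ^ 2 / (K N : ℝ)) =
        A ^ 2 + 1 / (K N : ℝ) + (d⁻¹ * (S f ^ 2 / (K N : ℝ)) + (S f ^ 2)⁻¹ * (d * A ^ 2)) := by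
      field_simp
      ring
    rw [e, e2]
    exact le_add_of_nonneg_right (by positivity)
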